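/- Let $\rho_0$ be a Borel probability measure on $\mathbb{R}$ with $\int_{\mathbb{R}} x^2\,d\rho_0(x)<\infty$, and let $v_0:\mathbb{R}\to\mathbb{R}$ be absolutely continuous on $\mathbb{R}$: for every $\varepsilon>0$ there is $\delta>0$ such that $\sum_{i}|v_0(b_i)-v_0(a_i)|<\varepsilon$ for every finite family of pairwise disjoint intervals $(a_i,b_i)\subset\mathbb{R}$ with $\sum_i(b_i-a_i)<\delta$. Then there is a weak solution pair $(\rho,v)$ of the sticky particle system $$\partial_t\rho+\partial_x(\rho v)=0,\qquad \partial_t(\rho v)+\partial_x(\rho v^2)=0\qquad\text{in }\mathbb{R}\times(0,\infty)$$ with initial conditions $\rho|_{t=0}=\rho_0$, $v|_{t=0}=v_0$. That is, $v_0$ is continuous and $\rho_0$-integrable, $t\mapsto\rho_t$ is a narrowly continuous map from $[0,\infty)$ to the Borel probability measures on $\mathbb{R}$, $v:\mathbb{R}\times[0,\infty)\to\mathbb{R}$ is Borel measurable, $\int_0^T\!\int_{\mathbb{R}} v^2\,d\rho_t\,dt<\infty$ for every $T>0$, and for every $\phi\in C_c^\infty(\mathbb{R}\times[0,\infty))$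 $$\int_0^\infty\!\!\int_{\mathbb{R}}(\partial_t\phi+v\,\partial_x\phi)\,d\rho_t\,dt+\int_{\mathbb{R}}\phi(\cdot,0)\,d\rho_0=0,$$ $$\int_0^\infty\!\!\int_{\mathbb{R}}(v\,\partial_t\phi+v^2\,\partial_x\phi)\,d\rho_t\,dt+\int_{\mathbb{R}}\phi(\cdot,0)\,v_0\,d\rho_0=0.$$ Moreover, the pair can be chosen so that the following hold. * There is an absolutely continuous $X:[0,\infty)\to L^2(\rho_0)$ with $X(0)=\mathrm{id}_{\mathbb{R}}$ $\rho_0$-a.e. and $\dot X(t)=\mathbb{E}_{\rho_0}[v_0\,|\,X(t)]$ for a.e. $t\ge0$, such that $\rho_t=X(t)_{\#}\rho_0$ for every $t\ge0$, and $v$ is a Radon–Nikodym density of $\pi$ with respect to $\mu$, where, for Borel $S\subset\mathbb{R}\times[0,\infty)$, $$\pi(S)=\int_0^\infty\!\Big(\int_{\mathbb{R}}v_0\,\chi_S(X(t),t)\,d\rho_0\Big)e^{-t}\,dt,\qquad \mu(S)=\int_0^\infty\!\Big(\int_{\mathbb{R}}\chi_S(x,t)\,d\rho_t(x)\Big)e^{-t}\,dt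 .$$ Furthermore $v(X(t),t)=\dot X(t)$ $\rho_0$-a.e., for a.e. $t\ge 0$. * (i) $\int_{\mathbb{R}}\tfrac12v_0^2\,d\rho_0<\infty$, and there is a Lebesgue null set $N\subset[0,\infty)$ such that for all $s,t\in[0,\infty)\setminus N$ with $s\le t$, $$\int_{\mathbb{R}}\tfrac12v(x,t)^2\,d\rho_t(x)\le\int_{\mathbb{R}}\tfrac12v(x,s)^2\,d\rho_s(x)\le\int_{\mathbb{R}}\tfrac12v_0(x)^2\,d\rho_0(x).$$ * (ii) For Lebesgue almost every $t\in(0,\infty)$ there is a Borel set $A\subset\mathbb{R}$ with $\rho_t(\mathbb{R}\setminus A)=0$ such that, for all $x,y\in A$, $$(v(x,t)-v(y,t))(x-y)\le\frac1t(x-y)^2 .$$ -/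

import Mathlib

open MeasureTheory Set Filter Topology
open scoped ContDiff ENNReal

noncomputable section

/-- `f` is absolutely continuous on the (possibly unbounded) interval `s`: for every `ε > 0` there
is one `δ > 0`, valid on all of `s`, such that for every finite family of pairwise disjoint open
intervals `(a i, b i)` with end points in `s` and total length less than `δ`, the total increment of
`f` over the family is less than `ε`. -/
def AbsolutelyContinuousOn {E : Type*} [PseudoMetricSpace E] (f : ℝ → E) (s : Set ℝ) : Prop :=
  ∀ ε : ℝ, 0 < ε → ∃ δ : ℝ, 0 < δ ∧
    ∀ (n : ℕ) (a b : Fin n → ℝ),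
      (∀ i, a i ∈ s ∧ b i ∈ s ∧ a i ≤ b i) →
      (∀ i j, i ≠ j → Disjoint (Ioo (a i) (b i)) (Ioo (a j) (b j))) →
      ∑ i, (b i - a i) < δ →
      ∑ i, dist (f (a i)) (f (b i)) < ε

/-- A weak solution pair `(ρ, v)` of the sticky particle system
`∂ₜρ + ∂ₓ(ρv) = 0`, `∂ₜ(ρv) + ∂ₓ(ρv²) = 0` on `ℝ × (0,∞)` with initial data `(ρ₀, v₀)`.
Time is a real variable; only the values at times `t ≥ 0` matter. A test function of class
`C_c^∞(ℝ × [0,∞))` is given by a function of class `C_c^∞(ℝ × ℝ)`, of which only the restriction to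
`ℝ × [0,∞)` is used; it need not vanish at `t = 0`. The topology of `ProbabilityMeasure ℝ` is that
of narrow convergence. -/
structure IsWeakSolutionPair (ρ₀ : Measure ℝ) (v₀ : ℝ → ℝ)
    (ρ : ℝ → ProbabilityMeasure ℝ) (v : ℝ → ℝ → ℝ) : Prop where
  continuous_init : Continuous v₀
  integrable_init : Integrable v₀ ρ₀
  narrowly_continuous : ContinuousOn ρ (Ici 0)
  measurable_velocity : Measurable (fun p : ℝ × ℝ => v p.1 p.2)
  finite_action : ∀ T : ℝ, 0 < T →
    ∫⁻ t in Icc 0 T, ∫⁻ x, ENNReal.ofReal (v x t ^ 2) ∂(ρ t : Measure ℝ) < ⊤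
  mass : ∀ φ : ℝ → ℝ → ℝ, ContDiff ℝ ∞ (fun p : ℝ × ℝ => φ p.1 p.2) →
    HasCompactSupport (fun p : ℝ × ℝ => φ p.1 p.2) →
    (∫ t in Ici (0 : ℝ), ∫ x,
        (deriv (fun τ => φ x τ) t + v x t * deriv (fun ξ => φ ξ t) x) ∂(ρ t : Measure ℝ))
      + ∫ x, φ x 0 ∂ρ₀ = 0
  momentum : ∀ φ : ℝ → ℝ → ℝ, ContDiff ℝ ∞ (fun p : ℝ × ℝ => φ p.1 p.2) →
    HasCompactSupport (fun p : ℝ × ℝ => φ p.1 p.2) →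
    (∫ t in Ici (0 : ℝ), ∫ x,
        (v x t * deriv (fun τ => φ x τ) t + v x t ^ 2 * deriv (fun ξ => φ ξ t) x)
          ∂(ρ t : Measure ℝ))
      + ∫ x, φ x 0 * v₀ x ∂ρ₀ = 0

/-- The conditional expectation `E_{ρ₀}[g | Y]` of `g` given the random variable `Y`. -/
def condExpGiven (ρ₀ : Measure ℝ) (g Y : ℝ → ℝ) : ℝ → ℝ :=
  ρ₀[g | MeasurableSpace.comap Y (inferInstance : MeasurableSpace ℝ)]

/-- `X : [0,∞) → L²(ρ₀)` is an absolutely continuous solution of the sticky particle flow equation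
`Ẋ(t) = E_{ρ₀}[v₀ | X(t)]` for a.e. `t ≥ 0`, with `X(0) = id`. The derivative is that of an
`L²(ρ₀)`-valued function of time. -/
structure IsStickyParticleFlow (ρ₀ : Measure ℝ) (v₀ : ℝ → ℝ) (X : ℝ → Lp ℝ 2 ρ₀) : Prop where
  absolutely_continuous : AbsolutelyContinuousOn X (Ici 0)
  flow : ∀ᵐ t ∂(volume.restrict (Ici (0 : ℝ))),
    DifferentiableAt ℝ X t ∧ ((deriv X t : Lp ℝ 2 ρ₀) : ℝ → ℝ) =ᵐ[ρ₀] condExpGiven ρ₀ v₀ (X t)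
  init : (X 0 : ℝ → ℝ) =ᵐ[ρ₀] id

/-- With the measures on `ℝ × [0,∞)`
`μ(S) = ∫₀^∞ ρ_t({x | (x,t) ∈ S}) e^{-t} dt` and
`π(S) = ∫₀^∞ (∫ v₀(y) 1_S(X(y,t),t) dρ₀(y)) e^{-t} dt`,
the function `v` is a Radon-Nikodym density of `π` with respect to `μ`. -/
def IsRadonNikodymVelocity (ρ₀ : Measure ℝ) (v₀ : ℝ → ℝ) (X : ℝ → Lp ℝ 2 ρ₀)
    (ρ : ℝ → ProbabilityMeasure ℝ) (v : ℝ → ℝ → ℝ) : Prop :=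
  ∀ S : Set (ℝ × ℝ), MeasurableSet S →
    ∫ t in Ici (0 : ℝ), (∫ y, S.indicator (fun _ => v₀ y) (X t y, t) ∂ρ₀) * Real.exp (-t) =
      ∫ t in Ici (0 : ℝ),
        (∫ x, S.indicator (fun p => v p.1 p.2) (x, t) ∂(ρ t : Measure ℝ)) * Real.exp (-t)

/-- The kinetic energy `∫ ½ w² dm`, as an extended nonnegative number. -/
def kineticEnergy (m : Measure ℝ) (w : ℝ → ℝ) : ℝ≥0∞ :=
  ∫⁻ x, ENNReal.ofReal (1 / 2 * w x ^ 2) ∂m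

end

/-! The flow is explicit: `x t` is the `L²(ρ₀)` projection of the free motion `e + t w`, with `e =
id` and `w = v₀`, onto the closed convex cone `K` of monotone maps.

Such a projection is a conditional expectation given itself (`IsConeProj.condProj_eq`): a small
increasing change of `x t` as a function of its own value stays in `K` in both directions, so the
residual is orthogonal to all functions of `x t`. Hence `x t = E_t (e + t w)`, where `E_t`
conditions on `x t`.

Particles that have met stay together. `E_s` maps `K` into itself, and Chebyshev's inequality on the
fibres of `x s` makes `e - E_s e` pair nonnegatively with `K`. By `isConeProj_of_restart` the
projection at a later time can then be computed inside the range of `E_s`, so `x t` is a function of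
`x s` and the projections `E_t` decrease.

Consequently `‖E_t w‖²` is nonincreasing, which is the energy inequality. It is continuous off a
countable set, and at its continuity points `x` is differentiable with derivative `E_t w = E[v₀ | x
t]`. Solving `x t = E_t e + t E_t w` for the velocity, with `E_t e` a monotone function of `x t`,
gives the entropy inequality.

Both weak equations come from differentiating `∫ h φ(x t, t) dρ₀`, with `h = 1` for mass and `h =
v₀` for momentum; self-adjointness of `E_t` replaces `v₀` by the velocity. A velocity field
measurable in space and time is obtained by conditioning on position and time jointly. -/

open ProbabilityTheory

/-! ### Projections onto cones and decreasing families of orthogonal projections in a Hilbert space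
-/

section ConeProjection

variable {H : Type*} [NormedAddCommGroup H] [InnerProductSpace ℝ H]

/-- `p` is the metric projection of `f` onto the convex cone `K`, by Moreau's characterisation. -/
structure IsConeProj (K : Set H) (f p : H) : Prop where
  mem : p ∈ K
  inner_self : inner ℝ (f - p) p = 0
  inner_le : ∀ g ∈ K, inner ℝ (f - p) g ≤ 0

/-- A closed convex cone containing the origin. -/
structure IsClosedConvexCone (K : Set H) : Prop where
  closed : IsClosed K
  zero : (0 : H) ∈ K
  add : ∀ f ∈ K, ∀ g ∈ K, f + g ∈ K
  smul : ∀ c : ℝ, 0 ≤ c → ∀ f ∈ K, c • f ∈ K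

lemma IsClosedConvexCone.exists_isConeProj [CompleteSpace H] {K : Set H}
    (hK : IsClosedConvexCone K) (f : H) : ∃ p, IsConeProj K f p := by
  have hconv : Convex ℝ K := fun x hx y hy a b ha hb _ =>
    hK.add _ (hK.smul a ha x hx) _ (hK.smul b hb y hy)
  obtain ⟨p, hp, hn⟩ := exists_norm_eq_iInf_of_complete_convex ⟨0, hK.zero⟩
    hK.closed.isComplete hconv f
  rw [norm_eq_iInf_iff_real_inner_le_zero hconv hp] at hn
  refine ⟨p, hp, le_antisymm ?_ ?_, fun g hg => ?_⟩
  · simpa using hn (p + p) (hK.add _ hp _ hp)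
  · simpa using hn 0 hK.zero
  · simpa using hn (p + g) (hK.add _ hp _ hg)

lemma IsConeProj.norm_sub_le {K : Set H} {f f' p p' : H}
    (h : IsConeProj K f p) (h' : IsConeProj K f' p') : ‖p - p'‖ ≤ ‖f - f'‖ := by
  have h1 := h.inner_le p' h'.mem
  have h2 := h'.inner_le p h.mem
  have h3 := h.inner_self
  have h4 := h'.inner_self
  have h5 : ‖p - p'‖ ^ 2 ≤ inner ℝ (f - f') (p - p') := by
    rw [← real_inner_self_eq_norm_sq]
    simp only [inner_sub_left, inner_sub_right] at *
    linarith
  have h6 := real_inner_le_norm (f - f') (p - p')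
  by_contra! hlt
  nlinarith [norm_nonneg (p - p'), norm_nonneg (f - f')]

lemma IsConeProj.unique {K : Set H} {f p p' : H}
    (h : IsConeProj K f p) (h' : IsConeProj K f p') : p = p' := by
  have := h.norm_sub_le h'
  rw [sub_self, norm_zero] at this
  exact sub_eq_zero.1 (norm_le_zero_iff.1 this)

lemma isConeProj_self {K : Set H} {p : H} (hp : p ∈ K) : IsConeProj K p p :=
  ⟨hp, by simp, by simp⟩

/-- A self-adjoint idempotent operator, that is, an orthogonal projection. -/
structure IsOrthProj (E : H →L[ℝ] H) : Prop where
  symm : ∀ f g, inner ℝ (E f) g = inner ℝ f (E g)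
  idem : ∀ f, E (E f) = E f

lemma IsClosedConvexCone.inter_fixed {K : Set H} (hK : IsClosedConvexCone K) (E : H →L[ℝ] H) :
    IsClosedConvexCone (K ∩ {f | E f = f}) where
  closed := hK.closed.inter (isClosed_eq E.continuous continuous_id)
  zero := ⟨hK.zero, by simp⟩
  add f hf g hg := ⟨hK.add _ hf.1 _ hg.1, by
    have h1 := hf.2; have h2 := hg.2; simp only [mem_ofPred_eq] at *; simp [h1, h2]⟩
  smul c hc f hf := ⟨hK.smul c hc _ hf.1, by have h1 := hf.2; simp only [mem_ofPred_eq] at *; simp [h1]⟩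

/-- Let `x = P_K (e + s w)`. If the orthogonal projection `E` fixes the information in `x`,
preserves `K` and decreases the pairing of `e` with `K`, then the projection onto `K` at a later
time can be computed inside the range of `E`, starting from `x` with velocity `E w`. -/
lemma isConeProj_of_restart {K : Set H} {E : H →L[ℝ] H} (hE : IsOrthProj E)
    {e w x p : H} {s t : ℝ} (hs : 0 < s) (hst : s ≤ t)
    (hx : IsConeProj K (e + s • w) x) (hEx : E (e + s • w) = x)
    (hEK : ∀ g ∈ K, E g ∈ K) (hcov : ∀ g ∈ K, 0 ≤ inner ℝ (e - E e) g)
    (hp : IsConeProj (K ∩ {f | E f = f}) (E (e + t • w)) p) : IsConeProj K (e + t • w) p := by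
  have hEp : E p = p := hp.mem.2
  refine ⟨hp.mem.1, ?_, fun g hg => ?_⟩
  · have h := hp.inner_self
    rw [inner_sub_left, hE.symm, hEp, ← inner_sub_left] at h
    exact h
  · have h1 := hp.inner_le (E g) ⟨hEK g hg, hE.idem g⟩
    have h2 := hx.inner_le g hg
    have h3 := hcov g hg
    -- On the range of `1 - E`, extrapolate from the times `0` and `s`: `e + t w = (t/s) (e + s w) -
    -- (t/s - 1) e`. The signs are right because `t/s ≥ 1`.
    have h4 : inner ℝ (e + t • w - p) g = inner ℝ (E (e + t • w) - p) (E g)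
        + ((t / s) * inner ℝ (e + s • w - x) g - (t / s - 1) * inner ℝ (e - E e) g) := by
      have h5 : inner ℝ p (E g) = inner ℝ p g := by rw [← hE.symm, hEp]
      rw [← hEx]
      simp only [inner_sub_left, inner_add_left, inner_smul_left, map_add, map_smul, hE.symm,
        hE.idem, h5]
      simp only [conj_trivial]
      field_simp
      ring
    have h6 : 1 ≤ t / s := by rwa [one_le_div hs]
    rw [h4]
    nlinarith

lemma IsOrthProj.norm_sub_sq {E F : H →L[ℝ] H} (hE : IsOrthProj E) (hF : IsOrthProj F)
    (hEF : ∀ f, E (F f) = F f) (w : H) :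
    ‖E w - F w‖ ^ 2 = ‖E w‖ ^ 2 - ‖F w‖ ^ 2 := by
  have h : inner ℝ (E w) (F w) = ‖F w‖ ^ 2 := by
    rw [hE.symm, hEF, ← real_inner_self_eq_norm_sq, hF.symm, hF.idem]
  rw [norm_sub_sq_real, h]; ring

lemma IsOrthProj.norm_le {E : H →L[ℝ] H} (hE : IsOrthProj E) (w : H) : ‖E w‖ ≤ ‖w‖ := by
  have h : ‖E w‖ ^ 2 = inner ℝ (E w) w := by
    rw [← real_inner_self_eq_norm_sq, hE.symm, hE.idem, ← hE.symm]
  have h1 := real_inner_le_norm (E w) w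
  by_contra! hlt
  nlinarith [norm_nonneg w]

/-- A curve `x t = E t (e + t w)` generated by a decreasing family of orthogonal projections. -/
structure IsProjectedLine (E : ℝ → H →L[ℝ] H) (e w : H) (x : ℝ → H) : Prop where
  proj : ∀ t, 0 < t → IsOrthProj (E t)
  comp_left : ∀ s t, 0 < s → s ≤ t → ∀ f, E t (E s f) = E t f
  comp_right : ∀ s t, 0 < s → s ≤ t → ∀ f, E s (E t f) = E t f
  eq_proj : ∀ t, 0 < t → x t = E t (e + t • w)
  norm_sub_le : ∀ s t, 0 < s → s ≤ t → ‖x t - x s‖ ≤ (t - s) * ‖E s w‖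

namespace IsProjectedLine

variable {E : ℝ → H →L[ℝ] H} {e w : H} {x : ℝ → H}

lemma norm_sub_sq (h : IsProjectedLine E e w x) {s t : ℝ} (hs : 0 < s) (hst : s ≤ t) :
    ‖E s w - E t w‖ ^ 2 = ‖E s w‖ ^ 2 - ‖E t w‖ ^ 2 :=
  (h.proj s hs).norm_sub_sq (h.proj t (hs.trans_le hst))
    (h.comp_right s t hs hst) w

lemma antitoneOn (h : IsProjectedLine E e w x) :
    AntitoneOn (fun t => ‖E t w‖ ^ 2) (Ioi 0) := fun s hs t _ hst => by
  have := h.norm_sub_sq hs hst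
  have := sq_nonneg ‖E s w - E t w‖
  dsimp only
  linarith

/-- Since `E t (x s) = E t (e + s w) = x t - (t - s) E t w`, the remainder is orthogonal to `E t w`.
Pythagoras and the speed bound `‖E s w‖` leave only the loss of energy. -/
lemma norm_remainder_sq_le (h : IsProjectedLine E e w x) {s t : ℝ} (hs : 0 < s) (hst : s ≤ t) :
    ‖x t - x s - (t - s) • E t w‖ ^ 2 ≤ (t - s) ^ 2 * (‖E s w‖ ^ 2 - ‖E t w‖ ^ 2) := by
  have ht := hs.trans_le hst
  have hEt := h.proj t ht
  have h1 : E t (x s) = x t - (t - s) • E t w := by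
    rw [h.eq_proj s hs, h.comp_left s t hs hst, h.eq_proj t ht]
    simp only [map_add, map_smul, sub_smul]
    abel
  have hxt : E t (x t) = x t := by rw [h.eq_proj t ht, hEt.idem]
  have h2 : inner ℝ (x t - x s - (t - s) • E t w) (E t w) = 0 := by
    rw [← hEt.symm, map_sub, map_sub, hxt, h1, map_smul, hEt.idem]
    simp
  have h3 : ‖x t - x s‖ ^ 2 = ‖x t - x s - (t - s) • E t w‖ ^ 2 + (t - s) ^ 2 * ‖E t w‖ ^ 2 := by
    have : x t - x s = (x t - x s - (t - s) • E t w) + (t - s) • E t w := by abel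
    conv_lhs => rw [this]
    rw [norm_add_sq_real, inner_smul_right, h2, norm_smul, Real.norm_eq_abs, mul_pow, sq_abs]
    ring
  have h4 : ‖x t - x s‖ ^ 2 ≤ ((t - s) * ‖E s w‖) ^ 2 :=
    pow_le_pow_left₀ (norm_nonneg _) (h.norm_sub_le s t hs hst) 2
  nlinarith

lemma norm_remainder_le (h : IsProjectedLine E e w x) {r t : ℝ} (hr : 0 < r) (ht : 0 < t) :
    ‖x r - x t - (r - t) • E t w‖ ≤ 2 * √|‖E r w‖ ^ 2 - ‖E t w‖ ^ 2| * |r - t| := by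
  have key : ∀ {s t : ℝ}, 0 < s → s ≤ t →
      ‖x t - x s - (t - s) • E t w‖ ≤ √|‖E s w‖ ^ 2 - ‖E t w‖ ^ 2| * |t - s| := by
    intro s t hs hst
    rw [← Real.sqrt_sq_eq_abs (t - s), ← Real.sqrt_mul (abs_nonneg _)]
    refine Real.le_sqrt_of_sq_le ((h.norm_remainder_sq_le hs hst).trans ?_)
    rw [mul_comm]
    exact mul_le_mul_of_nonneg_right (le_abs_self _) (sq_nonneg _)
  rcases le_total r t with hrt | htr
  · have h1 := key hr hrt
    have h2 : x r - x t - (r - t) • E t w = -(x t - x r - (t - r) • E t w) := by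
      rw [show r - t = -(t - r) by ring, neg_smul]; abel
    rw [h2, norm_neg, abs_sub_comm r t]
    nlinarith [mul_nonneg (Real.sqrt_nonneg |‖E r w‖ ^ 2 - ‖E t w‖ ^ 2|) (abs_nonneg (t - r))]
  -- To the right of `t` the previous bound involves the later velocity `E r w`; exchanging it for
  -- `E t w` costs the same amount again, hence the factor 2.
  · have h1 := key ht htr
    have h2 : x r - x t - (r - t) • E t w
        = (x r - x t - (r - t) • E r w) - (r - t) • (E t w - E r w) := by
      rw [smul_sub]; abel
    have h3 : ‖E t w - E r w‖ = √|‖E t w‖ ^ 2 - ‖E r w‖ ^ 2| := by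
      rw [← h.norm_sub_sq ht htr, abs_of_nonneg (sq_nonneg _), Real.sqrt_sq (norm_nonneg _)]
    have h4 := _root_.norm_sub_le (x r - x t - (r - t) • E r w) ((r - t) • (E t w - E r w))
    rw [← h2, norm_smul, Real.norm_eq_abs, h3] at h4
    rw [abs_sub_comm (‖E r w‖ ^ 2)]
    linarith

lemma hasDerivAt (h : IsProjectedLine E e w x) {t : ℝ} (ht : 0 < t)
    (hc : ContinuousAt (fun r => ‖E r w‖ ^ 2) t) : HasDerivAt x (E t w) t := by
  rw [hasDerivAt_iff_isLittleO, Asymptotics.isLittleO_iff]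
  intro c hcpos
  have h1 : Tendsto (fun r => 2 * √|‖E r w‖ ^ 2 - ‖E t w‖ ^ 2|) (𝓝 t) (𝓝 0) := by
    have : ContinuousAt (fun r => 2 * √|‖E r w‖ ^ 2 - ‖E t w‖ ^ 2|) t :=
      ((hc.sub continuousAt_const).abs.sqrt).const_mul 2
    simpa [ContinuousAt] using this
  filter_upwards [h1.eventually_le_const hcpos, lt_mem_nhds ht] with r hr1 hr2
  exact (h.norm_remainder_le hr2 ht).trans (mul_le_mul_of_nonneg_right hr1 (abs_nonneg _))

/-- A monotone function, here the energy, has at most countably many discontinuities. -/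
lemma exists_countable_hasDerivAt (h : IsProjectedLine E e w x) :
    ∃ D : Set ℝ, D.Countable ∧ ∀ t, 0 < t → t ∉ D → HasDerivAt x (E t w) t := by
  refine ⟨_, h.antitoneOn.countable_not_continuousWithinAt, fun t ht htD => h.hasDerivAt ht ?_⟩
  simp only [mem_ofPred_eq, not_and, not_not] at htD
  exact (htD ht).continuousAt (Ioi_mem_nhds ht)

end IsProjectedLine

end ConeProjection

/-- A π-λ argument on rational rays. Countability of the test family later allows one exceptional
null set of times to serve all Borel sets. -/
lemma setIntegral_preimage_eq_zero {α : Type*} [MeasurableSpace α] {μ : Measure α}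
    {g : α → ℝ} (hg : Integrable g μ) {Y : α → ℝ} (hY : Measurable Y)
    (h0 : ∫ a, g a ∂μ = 0) (h : ∀ q : ℚ, ∫ a in Y ⁻¹' Ioi (q : ℝ), g a ∂μ = 0)
    {B : Set ℝ} (hB : MeasurableSet B) : ∫ a in Y ⁻¹' B, g a ∂μ = 0 := by
  induction B, hB using MeasurableSpace.induction_on_inter
    (BorelSpace.measurable_eq.trans Real.borel_eq_generateFrom_Ioi_rat) Real.isPiSystem_Ioi_rat with
  | empty => simp
  | basic B hB =>
    simp only [mem_iUnion, mem_singleton_iff] at hB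
    obtain ⟨q, rfl⟩ := hB
    exact h q
  | compl B hB ih =>
    have := integral_add_compl (hY hB) hg
    rw [preimage_compl]
    linarith
  | iUnion f hd hm ih =>
    rw [preimage_iUnion, integral_iUnion (fun i => hY (hm i))
      (fun i j hij => (hd hij).preimage Y) hg.integrableOn]
    simp [ih]

/-! ### The cone of monotone maps in `L²(ρ)` -/

section MonotoneCone

variable (ρ : Measure ℝ)

/-- The square integrable functions that are monotone on a set of full measure. -/
def monotoneCone : Set (Lp ℝ 2 ρ) := {f | ∃ A ∈ ae ρ, MonotoneOn (f : ℝ → ℝ) A}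

variable {ρ}

lemma mem_monotoneCone_of_ae_eq {f : Lp ℝ 2 ρ} {g : ℝ → ℝ} {A : Set ℝ} (hA : A ∈ ae ρ)
    (hg : MonotoneOn g A) (hfg : (f : ℝ → ℝ) =ᵐ[ρ] g) : f ∈ monotoneCone ρ := by
  refine ⟨A ∩ {x | f x = g x}, inter_mem hA hfg, fun x hx y hy hxy => ?_⟩
  rw [show f x = g x from hx.2, show f y = g y from hy.2]
  exact hg hx.1 hy.1 hxy

lemma isClosedConvexCone_monotoneCone : IsClosedConvexCone (monotoneCone ρ) where
  closed := by
    refine IsSeqClosed.isClosed fun u f hu hf => ?_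
    obtain ⟨ns, -, hns⟩ := (tendstoInMeasure_of_tendsto_Lp hf).exists_seq_tendsto_ae
    choose A hA hmono using hu
    refine ⟨{x | Tendsto (fun i => u (ns i) x) atTop (𝓝 (f x))} ∩ ⋂ n, A n,
      inter_mem hns (countable_iInter_mem.2 hA), fun x hx y hy hxy => ?_⟩
    exact le_of_tendsto_of_tendsto' hx.1 hy.1 fun i =>
      hmono _ (mem_iInter.1 hx.2 _) (mem_iInter.1 hy.2 _) hxy
  zero := mem_monotoneCone_of_ae_eq univ_mem ((monotone_const (c := (0 : ℝ))).monotoneOn _)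
    (Lp.coeFn_zero ℝ 2 ρ)
  add f hf g hg := by
    obtain ⟨A, hA, hfA⟩ := hf
    obtain ⟨B, hB, hgB⟩ := hg
    exact mem_monotoneCone_of_ae_eq (inter_mem hA hB)
      ((hfA.mono inter_subset_left).add (hgB.mono inter_subset_right)) (Lp.coeFn_add f g)
  smul c hc f hf := by
    obtain ⟨A, hA, hfA⟩ := hf
    exact mem_monotoneCone_of_ae_eq hA
      (fun x hx y hy hxy => mul_le_mul_of_nonneg_left (hfA hx hy hxy) hc) (Lp.coeFn_smul c f)

end MonotoneCone

/-! ### Conditional expectation given an `L²` map, as an orthogonal projection -/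

section CondProj

variable {ρ : Measure ℝ}

lemma Lp.measurable_coe (k : Lp ℝ 2 ρ) : Measurable (k : ℝ → ℝ) :=
  (Lp.stronglyMeasurable k).measurable

/-- The conditional expectation given the random variable `k`, as an operator on `L²(ρ)`. -/
noncomputable def condProj (k : Lp ℝ 2 ρ) : Lp ℝ 2 ρ →L[ℝ] Lp ℝ 2 ρ :=
  (lpMeas ℝ ℝ (MeasurableSpace.comap (k : ℝ → ℝ) inferInstance) 2 ρ).subtypeL ∘L
    condExpL2 ℝ ℝ (Lp.measurable_coe k).comap_le

lemma condProj_ae_eq_of_toLp [IsProbabilityMeasure ρ] (k : Lp ℝ 2 ρ) {f : ℝ → ℝ}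
    (hf : MemLp f 2 ρ) : (condProj k (hf.toLp f) : ℝ → ℝ) =ᵐ[ρ] condExpGiven ρ f k :=
  hf.condExpL2_ae_eq_condExp (𝕜 := ℝ) (Lp.measurable_coe k).comap_le

lemma condProj_ae_eq [IsProbabilityMeasure ρ] (k f : Lp ℝ 2 ρ) :
    (condProj k f : ℝ → ℝ) =ᵐ[ρ] condExpGiven ρ f k := by
  have := condProj_ae_eq_of_toLp k (Lp.memLp f)
  rwa [Lp.toLp_coeFn] at this

lemma condProj_aestronglyMeasurable (k f : Lp ℝ 2 ρ) :
    AEStronglyMeasurable[MeasurableSpace.comap (k : ℝ → ℝ) inferInstance] (condProj k f) ρ :=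
  aestronglyMeasurable_condExpL2 (Lp.measurable_coe k).comap_le f

lemma exists_condProj_ae_eq_comp (k f : Lp ℝ 2 ρ) :
    ∃ h : ℝ → ℝ, Measurable h ∧ (condProj k f : ℝ → ℝ) =ᵐ[ρ] h ∘ k := by
  have h1 := condProj_aestronglyMeasurable k f
  obtain ⟨h, hh, he⟩ := h1.stronglyMeasurable_mk.measurable.exists_eq_measurable_comp
  exact ⟨h, hh, h1.ae_eq_mk.trans (.of_eq he)⟩

lemma condProj_eq_self_of_ae_eq_comp [IsProbabilityMeasure ρ] {k f : Lp ℝ 2 ρ} {h : ℝ → ℝ}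
    (hh : Measurable h) (hf : (f : ℝ → ℝ) =ᵐ[ρ] h ∘ k) : condProj k f = f := by
  refine Lp.ext ((condProj_ae_eq k f).trans ?_)
  refine condExp_of_aestronglyMeasurable' (Lp.measurable_coe k).comap_le ?_
    ((Lp.memLp f).integrable one_le_two)
  exact ⟨h ∘ k, (hh.comp (comap_measurable _)).stronglyMeasurable, hf⟩

lemma isOrthProj_condProj [IsProbabilityMeasure ρ] (k : Lp ℝ 2 ρ) : IsOrthProj (condProj k) where
  symm f g := inner_condExpL2_left_eq_right (Lp.measurable_coe k).comap_le
  idem f := by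
    obtain ⟨h, hh, he⟩ := exists_condProj_ae_eq_comp k f
    exact condProj_eq_self_of_ae_eq_comp hh he

/-- The hypothesis says that `k'` is almost everywhere a function of `k`; this is then the tower
property, and the next lemma is its adjoint form. -/
lemma condProj_comp_of_fixed [IsProbabilityMeasure ρ] {k k' : Lp ℝ 2 ρ} (hk : condProj k k' = k')
    (f : Lp ℝ 2 ρ) : condProj k (condProj k' f) = condProj k' f := by
  obtain ⟨h, hh, he⟩ := exists_condProj_ae_eq_comp k' f
  obtain ⟨j, hj, hje⟩ := exists_condProj_ae_eq_comp k k'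
  rw [hk] at hje
  refine condProj_eq_self_of_ae_eq_comp (hh.comp hj) ?_
  filter_upwards [he, hje] with x h1 h2
  rw [h1, Function.comp_apply, h2]
  rfl

lemma condProj_comp_of_fixed' [IsProbabilityMeasure ρ] {k k' : Lp ℝ 2 ρ} (hk : condProj k k' = k')
    (f : Lp ℝ 2 ρ) : condProj k' (condProj k f) = condProj k' f := by
  refine ext_inner_right ℝ fun g => ?_
  rw [(isOrthProj_condProj k').symm, (isOrthProj_condProj k).symm, condProj_comp_of_fixed hk,
    ← (isOrthProj_condProj k').symm]

end CondProj

/-! ### Projection onto the monotone cone is a conditional expectation -/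

section ProjectionIsCondExp

variable {ρ : Measure ℝ}

lemma memLp_of_bounded [IsFiniteMeasure ρ] {g : ℝ → ℝ} (hg : Measurable g) (C : ℝ) (hC : ∀ x, |g x| ≤ C) :
    MemLp g 2 ρ :=
  MemLp.of_bound hg.aestronglyMeasurable C (Eventually.of_forall hC)

lemma real_inner_toLp {f : Lp ℝ 2 ρ} {g : ℝ → ℝ} (hg : MemLp g 2 ρ) :
    inner ℝ f (hg.toLp g) = ∫ x, f x * g x ∂ρ := by
  rw [L2.inner_def]
  refine integral_congr_ae ?_
  filter_upwards [hg.coeFn_toLp] with x hx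
  simp [hx, mul_comm]

variable [IsProbabilityMeasure ρ]

/-- Both `c ∘ k` and `k - c ∘ k` lie in the cone. As `f - k` is orthogonal to `k`, the two
variational inequalities have opposite signs. -/
lemma IsConeProj.integral_mul_comp_eq_zero {f k : Lp ℝ 2 ρ}
    (h : IsConeProj (monotoneCone ρ) f k) {c : ℝ → ℝ} (hc : Monotone c)
    (hc' : Monotone fun x => x - c x) (C : ℝ) (hC : ∀ x, |c x| ≤ C) :
    ∫ x, (f - k) x * c (k x) ∂ρ = 0 := by
  have hm : MemLp (fun x => c (k x)) 2 ρ :=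
    memLp_of_bounded (hc.measurable.comp (Lp.measurable_coe k)) C fun x => hC _
  obtain ⟨A, hA, hk⟩ := h.mem
  have h1 := h.inner_le (hm.toLp _) (mem_monotoneCone_of_ae_eq hA (hc.comp_monotoneOn hk)
    hm.coeFn_toLp)
  have h2 := h.inner_le (k - hm.toLp _) (mem_monotoneCone_of_ae_eq hA (hc'.comp_monotoneOn hk) (by
    filter_upwards [hm.coeFn_toLp, Lp.coeFn_sub k (hm.toLp _)] with x hx1 hx2
    rw [hx2, Pi.sub_apply, hx1]
    rfl))
  rw [inner_sub_right, h.inner_self] at h2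
  rw [← real_inner_toLp hm]
  linarith

lemma IsConeProj.condProj_eq {f k : Lp ℝ 2 ρ} (h : IsConeProj (monotoneCone ρ) f k) :
    condProj k f = k := by
  have hint : Integrable (f - k : Lp ℝ 2 ρ) ρ := (Lp.memLp _).integrable one_le_two
  have hzero : ∫ x, (f - k) x ∂ρ = 0 := by
    simpa using h.integral_mul_comp_eq_zero (c := fun _ => 1) monotone_const
      (fun x y hxy => by simpa using hxy) 1 (by simp)
  have hIoi : ∀ q : ℚ, ∫ x in k ⁻¹' Ioi (q : ℝ), (f - k) x ∂ρ = 0 := by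
    intro q
    -- Ramps of slope one, so that `c n` and `x - c n x` are both monotone. Rescaled by `n + 1` they
    -- converge pointwise to the indicator of `(q, ∞)` and stay below 1.
    let c : ℕ → ℝ → ℝ := fun n x => max 0 (min (x - q) (1 / (n + 1)))
    have hcn : ∀ n, ∫ x, (f - k) x * ((n + 1) * c n (k x)) ∂ρ = 0 := by
      intro n
      have hpos : (0 : ℝ) < 1 / (n + 1) := by positivity
      have := h.integral_mul_comp_eq_zero (c := c n)
        (fun x y hxy => max_le_max le_rfl (min_le_min (by linarith) le_rfl))
        (fun x y hxy => by
          simp only [c]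
          rcases max_cases 0 (min (x - (q : ℝ)) (1 / (n + 1))) with h1 | h1 <;>
          rcases max_cases 0 (min (y - (q : ℝ)) (1 / (n + 1))) with h2 | h2 <;>
          rcases min_cases (x - (q : ℝ)) (1 / ((n : ℝ) + 1)) with h3 | h3 <;>
          rcases min_cases (y - (q : ℝ)) (1 / ((n : ℝ) + 1)) with h4 | h4 <;> linarith)
        (1 / (n + 1)) (fun x => by
          rw [abs_of_nonneg (le_max_left _ _)]
          exact max_le hpos.le (min_le_right _ _))
      simp_rw [mul_left_comm _ ((n : ℝ) + 1)]
      rw [integral_const_mul, this, mul_zero]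
    have hlim : Tendsto (fun n : ℕ => ∫ x, (f - k) x * ((n + 1) * c n (k x)) ∂ρ) atTop
        (𝓝 (∫ x, (k ⁻¹' Ioi (q : ℝ)).indicator (f - k : Lp ℝ 2 ρ) x ∂ρ)) := by
      refine tendsto_integral_of_dominated_convergence (fun x => ‖(f - k) x‖) (fun n => ?_)
        hint.norm (fun n => Eventually.of_forall fun x => ?_) (Eventually.of_forall fun x => ?_)
      · refine hint.aestronglyMeasurable.mul (Measurable.aestronglyMeasurable ?_)
        have := Lp.measurable_coe k
        fun_prop
      · have hpos : (0 : ℝ) < 1 / (n + 1) := by positivity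
        have h1 : c n (k x) ≤ 1 / (n + 1) := max_le hpos.le (min_le_right _ _)
        have h2 : 0 ≤ c n (k x) := le_max_left _ _
        rw [norm_mul]
        refine mul_le_of_le_one_right (norm_nonneg _) ?_
        rw [Real.norm_of_nonneg (by positivity)]
        calc ((n : ℝ) + 1) * c n (k x) ≤ (n + 1) * (1 / (n + 1)) := by gcongr
          _ = 1 := by field_simp
      · by_cases hx : (q : ℝ) < k x
        · rw [indicator_of_mem (by exact hx)]
          refine tendsto_const_nhds.congr' ?_
          have := (tendsto_one_div_add_atTop_nhds_zero_nat (𝕜 := ℝ)).eventually_le_const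
            (sub_pos.2 hx)
          filter_upwards [this] with n hn
          have hpos : (0 : ℝ) < 1 / (n + 1) := by positivity
          simp only [c]
          rw [min_eq_right hn, max_eq_right hpos.le]
          field_simp
        · rw [indicator_of_notMem (by exact hx)]
          refine tendsto_const_nhds.congr fun n => ?_
          have hpos : (0 : ℝ) < 1 / (n + 1) := by positivity
          simp only [c]
          rw [min_eq_left (by linarith), max_eq_left (by linarith)]
          simp
    rw [integral_indicator (Lp.measurable_coe k measurableSet_Ioi)] at hlim
    exact tendsto_nhds_unique hlim (tendsto_const_nhds.congr fun n => (hcn n).symm)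
  refine Lp.ext ((condProj_ae_eq k f).trans (EventuallyEq.symm ?_))
  have hk : Integrable (k : ℝ → ℝ) ρ := (Lp.memLp _).integrable one_le_two
  have hf : Integrable (f : ℝ → ℝ) ρ := (Lp.memLp _).integrable one_le_two
  refine ae_eq_condExp_of_forall_setIntegral_eq (Lp.measurable_coe k).comap_le hf
    (fun s _ _ => hk.integrableOn) ?_ (comap_measurable _).aestronglyMeasurable
  rintro s ⟨B, hB, rfl⟩ -
  have := setIntegral_preimage_eq_zero hint (Lp.measurable_coe k) hzero hIoi hB
  rw [integral_congr_ae (ae_restrict_of_ae (Lp.coeFn_sub f k))] at this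
  simp only [Pi.sub_apply] at this
  rw [integral_sub hf.integrableOn hk.integrableOn] at this
  linarith

end ProjectionIsCondExp

/-! ### Disintegration along the fibres of a monotone map and Chebyshev's inequality -/

section Fibres

/-- Chebyshev's argument: integrate `(f x - f y) (g x - g y) ≥ 0` first in `y`, then in `x`. -/
lemma integral_mul_integral_le_of_monotoneOn {κ : Measure ℝ} [IsProbabilityMeasure κ]
    {f g : ℝ → ℝ} {A : Set ℝ} (hA : A ∈ ae κ) (hf : MonotoneOn f A) (hg : MonotoneOn g A)
    (hfi : Integrable f κ) (hgi : Integrable g κ) (hfg : Integrable (fun x => f x * g x) κ) :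
    (∫ x, f x ∂κ) * ∫ x, g x ∂κ ≤ ∫ x, f x * g x ∂κ := by
  have h1 : ∀ x ∈ A, 0 ≤ f x * g x - f x * (∫ y, g y ∂κ) - g x * (∫ y, f y ∂κ)
      + ∫ y, f y * g y ∂κ := by
    intro x hx
    have h2 : 0 ≤ ∫ y, (f x * g x - f x * g y - g x * f y + f y * g y) ∂κ := by
      refine integral_nonneg_of_ae ?_
      filter_upwards [hA] with y hy
      have : 0 ≤ (f x - f y) * (g x - g y) := by
        rcases le_total x y with h | h
        · exact mul_nonneg_of_nonpos_of_nonpos (sub_nonpos.2 (hf hx hy h))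
            (sub_nonpos.2 (hg hx hy h))
        · exact mul_nonneg (sub_nonneg.2 (hf hy hx h)) (sub_nonneg.2 (hg hy hx h))
      simp only [Pi.zero_apply]
      linarith
    have i1 : Integrable (fun y => f x * g x - f x * g y) κ :=
      (integrable_const _).sub (hgi.const_mul _)
    have i2 : Integrable (fun y => f x * g x - f x * g y - g x * f y) κ :=
      i1.sub (hfi.const_mul _)
    rw [integral_add i2 hfg, integral_sub i1 (hfi.const_mul _),
      integral_sub (integrable_const _) (hgi.const_mul _), integral_const_mul (f x) g,
      integral_const_mul (g x) f] at h2
    simpa using h2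
  have h3 : 0 ≤ ∫ x, (f x * g x - f x * (∫ y, g y ∂κ) - g x * (∫ y, f y ∂κ)
      + ∫ y, f y * g y ∂κ) ∂κ :=
    integral_nonneg_of_ae (by filter_upwards [hA] with x hx using h1 x hx)
  have i1 : Integrable (fun x => f x * g x - f x * ∫ y, g y ∂κ) κ := hfg.sub (hfi.mul_const _)
  have i2 : Integrable (fun x => f x * g x - f x * (∫ y, g y ∂κ) - g x * ∫ y, f y ∂κ) κ :=
    i1.sub (hgi.mul_const _)
  rw [integral_add i2 (integrable_const _), integral_sub i1 (hgi.mul_const _),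
    integral_sub hfg (hfi.mul_const _), integral_mul_const, integral_mul_const] at h3
  simp only [integral_const, probReal_univ, one_smul] at h3
  linarith

variable {ρ : Measure ℝ} [IsProbabilityMeasure ρ]

/-- The joint law of `(Y, id)` sits on the graph of `Y` over a full measure set, so almost every
conditional law sits on its own fibre. -/
lemma ae_condDistrib_id {Y : ℝ → ℝ} (hY : Measurable Y) {A : Set ℝ} (hA : A ∈ ae ρ) :
    ∀ᵐ r ∂(ρ.map Y), ∀ᵐ x ∂(condDistrib id Y ρ r), Y x = r ∧ x ∈ A := by
  obtain ⟨B, hB0, hB, hBA⟩ := IsMeasurablyGenerated.exists_measurable_subset hA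
  have h : ∀ᵐ r ∂(ρ.map Y), ∀ᵐ x ∂(condDistrib id Y ρ r), Y x = r ∧ x ∈ B := by
    refine Measure.ae_ae_of_ae_compProd (p := fun q => Y q.2 = q.1 ∧ q.2 ∈ B) ?_
    have hm : MeasurableSet {q : ℝ × ℝ | Y q.2 = q.1 ∧ q.2 ∈ B} :=
      (measurableSet_eq_fun (hY.comp measurable_snd) measurable_fst).inter (measurable_snd hB)
    rw [compProd_map_condDistrib aemeasurable_id, ae_map_iff (hY.prodMk measurable_id).aemeasurable
      hm]
    filter_upwards [hB0] with x hx using ⟨rfl, hx⟩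
  filter_upwards [h] with r hr
  filter_upwards [hr] with x hx using ⟨hx.1, hBA hx.2⟩

lemma ae_integrable_condDistrib_id {Y : ℝ → ℝ} {g : ℝ → ℝ}
    (hg : Integrable g ρ) : ∀ᵐ r ∂(ρ.map Y), Integrable g (condDistrib id Y ρ r) := by
  have : Integrable (fun x : ℝ × ℝ => g x.2) (ρ.map fun x => (Y x, id x)) :=
    hg.comp_snd_map_prodMk Y
  exact this.condDistrib_ae_map aemeasurable_id

/-- The conditional expectation of a monotone function given a monotone random variable `Y` is a
monotone function of `Y`. -/
lemma exists_monotoneOn_condExpGiven {Y g : ℝ → ℝ} (hY : Measurable Y) (hgm : Measurable g)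
    (hg : Integrable g ρ) {A : Set ℝ} (hA : A ∈ ae ρ) (hYA : MonotoneOn Y A)
    (hgA : MonotoneOn g A) : ∃ G : ℝ → ℝ, Measurable G ∧
      ∃ R ∈ ae (ρ.map Y), MonotoneOn G R ∧ condExpGiven ρ g Y =ᵐ[ρ] G ∘ Y := by
  refine ⟨fun r => ∫ x, g x ∂(condDistrib id Y ρ r),
    (StronglyMeasurable.integral_condDistrib
      (hgm.comp measurable_snd).stronglyMeasurable).measurable, _,
    (ae_condDistrib_id hY hA).and (ae_integrable_condDistrib_id hg), ?_,
    condExp_ae_eq_integral_condDistrib_id hY hg⟩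
  rintro r ⟨hr, hri⟩ s ⟨hs, hsi⟩ hrs
  rcases hrs.eq_or_lt with rfl | hlt
  · rfl
  -- For `r < s` monotonicity of `Y` puts the fibre over `r` to the left of the fibre over `s`, so
  -- `g` is no larger on the former.
  have h1 : ∀ y, Y y = s ∧ y ∈ A → ∫ x, g x ∂(condDistrib id Y ρ r) ≤ g y := by
    rintro y ⟨rfl, hyA⟩
    have : ∫ x, g x ∂(condDistrib id Y ρ r) ≤ ∫ _, g y ∂(condDistrib id Y ρ r) := by
      refine integral_mono_ae hri (integrable_const _) ?_
      filter_upwards [hr] with x hx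
      refine hgA hx.2 hyA ?_
      by_contra! hyx
      exact (hYA hyA hx.2 hyx.le).not_gt (hx.1 ▸ hlt)
    simpa using this
  have h2 : ∫ _, (∫ x, g x ∂(condDistrib id Y ρ r)) ∂(condDistrib id Y ρ s)
      ≤ ∫ y, g y ∂(condDistrib id Y ρ s) := by
    refine integral_mono_ae (integrable_const _) hsi ?_
    filter_upwards [hs] with y hy using h1 y hy
  simpa using h2

lemma condExpGiven_mul_le {Y f g : ℝ → ℝ} (hY : Measurable Y) (hf : Integrable f ρ)
    (hg : Integrable g ρ) (hfg : Integrable (fun x => f x * g x) ρ) {A : Set ℝ} (hA : A ∈ ae ρ)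
    (hfA : MonotoneOn f A) (hgA : MonotoneOn g A) :
    ∀ᵐ x ∂ρ, condExpGiven ρ f Y x * condExpGiven ρ g Y x
      ≤ condExpGiven ρ (fun x => f x * g x) Y x := by
  have h : ∀ᵐ r ∂(ρ.map Y), (∫ x, f x ∂(condDistrib id Y ρ r)) * (∫ x, g x ∂(condDistrib id Y ρ r))
      ≤ ∫ x, f x * g x ∂(condDistrib id Y ρ r) := by
    filter_upwards [ae_condDistrib_id hY hA, ae_integrable_condDistrib_id hf,
      ae_integrable_condDistrib_id hg, ae_integrable_condDistrib_id hfg] with r h1 h2 h3 h4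
    exact integral_mul_integral_le_of_monotoneOn (h1.mono fun x hx => hx.2) hfA hgA h2 h3 h4
  filter_upwards [ae_of_ae_map hY.aemeasurable h, condExp_ae_eq_integral_condDistrib_id hY hf,
    condExp_ae_eq_integral_condDistrib_id hY hg,
    condExp_ae_eq_integral_condDistrib_id hY hfg] with x h1 h2 h3 h4
  simp only [condExpGiven] at *
  rw [h2, h3, h4]
  exact h1

lemma condProj_mem_monotoneCone {k g : Lp ℝ 2 ρ} (hk : k ∈ monotoneCone ρ)
    (hg : g ∈ monotoneCone ρ) : condProj k g ∈ monotoneCone ρ := by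
  obtain ⟨A, hA, hkA⟩ := hk
  obtain ⟨B, hB, hgB⟩ := hg
  obtain ⟨G, -, R, hR, hG, he⟩ := exists_monotoneOn_condExpGiven (Lp.measurable_coe k)
    (Lp.measurable_coe g)
    ((Lp.memLp g).integrable one_le_two) (inter_mem hA hB) (hkA.mono inter_subset_left)
    (hgB.mono inter_subset_right)
  refine mem_monotoneCone_of_ae_eq (A := A ∩ k ⁻¹' R)
    (inter_mem hA (ae_of_ae_map (Lp.measurable_coe k).aemeasurable hR)) ?_
    ((condProj_ae_eq k g).trans he)
  exact fun x hx y hy hxy => hG hx.2 hy.2 (hkA hx.1 hy.1 hxy)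

/-- Self-adjointness and idempotence turn the pairing of `condProj k f` with `g` into that of the
two conditional expectations, and Chebyshev on each fibre bounds it by the pairing of `f` with `g`.
-/
lemma inner_sub_condProj_nonneg (k : Lp ℝ 2 ρ) {f g : Lp ℝ 2 ρ} (hf : f ∈ monotoneCone ρ)
    (hg : g ∈ monotoneCone ρ) : 0 ≤ inner ℝ (f - condProj k f) g := by
  obtain ⟨A, hA, hfA⟩ := hf
  obtain ⟨B, hB, hgB⟩ := hg
  have hfg : Integrable (fun x => f x * g x) ρ := (Lp.memLp f).integrable_mul (Lp.memLp g)
  have hE := isOrthProj_condProj k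
  have h1 : inner ℝ (condProj k f) g = inner ℝ (condProj k f) (condProj k g) := by
    rw [hE.symm f (condProj k g), hE.idem, ← hE.symm]
  have h2 := condExpGiven_mul_le (Lp.measurable_coe k) ((Lp.memLp f).integrable one_le_two)
    ((Lp.memLp g).integrable one_le_two) hfg (inter_mem hA hB) (hfA.mono inter_subset_left)
    (hgB.mono inter_subset_right)
  have h3 : ∫ x, condProj k f x * condProj k g x ∂ρ ≤ ∫ x, f x * g x ∂ρ := by
    rw [← integral_condExp (Lp.measurable_coe k).comap_le (f := fun x => f x * g x)]
    refine integral_mono_ae ((Lp.memLp _).integrable_mul (Lp.memLp _)) integrable_condExp ?_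
    filter_upwards [h2, condProj_ae_eq k f, condProj_ae_eq k g] with x hx hx1 hx2
    rw [hx1, hx2]
    exact hx
  rw [inner_sub_left, h1, L2.inner_def, L2.inner_def, sub_nonneg]
  simpa [mul_comm] using h3

end Fibres

/-! ### Consequences of global absolute continuity -/

section AbsolutelyContinuous

lemma AbsolutelyContinuousOn.exists_dist_lt {E : Type*} [PseudoMetricSpace E] {f : ℝ → E}
    (hf : AbsolutelyContinuousOn f univ) {ε : ℝ} (hε : 0 < ε) :
    ∃ δ > 0, ∀ x y, |x - y| < δ → dist (f x) (f y) < ε := by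
  obtain ⟨δ, hδ, h⟩ := hf ε hε
  refine ⟨δ, hδ, fun x y hxy => ?_⟩
  have key : ∀ a b : ℝ, a ≤ b → b - a < δ → dist (f a) (f b) < ε := fun a b hab hlt => by
    simpa using h 1 (fun _ => a) (fun _ => b) (fun _ => ⟨trivial, trivial, hab⟩)
      (fun i j hij => absurd (Subsingleton.elim i j) hij) (by simpa using hlt)
  rcases le_total x y with hle | hle
  · exact key x y hle (by rw [abs_sub_comm] at hxy; exact (le_abs_self _).trans_lt hxy)
  · rw [dist_comm]
    exact key y x hle ((le_abs_self _).trans_lt hxy)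

lemma AbsolutelyContinuousOn.continuous {E : Type*} [PseudoMetricSpace E] {f : ℝ → E}
    (hf : AbsolutelyContinuousOn f univ) : Continuous f := by
  rw [Metric.continuous_iff]
  intro b ε hε
  obtain ⟨δ, hδ, h⟩ := hf.exists_dist_lt hε
  exact ⟨δ, hδ, fun a hab => h a b hab⟩

/-- One `δ` serves the whole line, so a walk from `0` to `x` takes about `2|x|/δ` steps, each
changing `f` by less than 1. This makes `v₀` square integrable when second moments are finite. -/
lemma AbsolutelyContinuousOn.exists_linear_growth {f : ℝ → ℝ}
    (hf : AbsolutelyContinuousOn f univ) : ∃ C, ∀ x, |f x| ≤ C * (1 + |x|) := by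
  obtain ⟨δ, hδ, h⟩ := hf.exists_dist_lt one_pos
  have key : ∀ n : ℕ, ∀ x : ℝ, |x| ≤ n * (δ / 2) → |f x - f 0| ≤ n := by
    intro n
    induction n with
    | zero => intro x hx; simp at hx; simp [hx]
    | succ n ih =>
      intro x hx
      have hn : (0 : ℝ) < n + 1 := by positivity
      push_cast at hx ⊢
      have h1 : |x| / (n + 1) ≤ δ / 2 := by rw [div_le_iff₀ hn]; linarith
      -- The last but one point when `[0, x]` is cut into `n + 1` equal steps.
      have h2 := ih (x * (n / (n + 1))) (by
        rw [abs_mul, abs_of_nonneg (show (0 : ℝ) ≤ n / (n + 1) by positivity)]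
        calc |x| * (n / (n + 1)) = n * (|x| / (n + 1)) := by ring
          _ ≤ n * (δ / 2) := by gcongr)
      have h3 := h x (x * (n / (n + 1))) (by
        rw [show x - x * (n / (n + 1)) = x / (n + 1) by field_simp; ring, abs_div, abs_of_pos hn]
        linarith)
      rw [Real.dist_eq] at h3
      have := abs_sub_le (f x) (f (x * (n / (n + 1)))) (f 0)
      linarith
  refine ⟨|f 0| + 1 + 2 / δ, fun x => ?_⟩
  have h1 := key ⌈|x| / (δ / 2)⌉₊ x (by
    rw [← div_le_iff₀ (by positivity)]; exact Nat.le_ceil _)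
  have h2 : (⌈|x| / (δ / 2)⌉₊ : ℝ) < |x| / (δ / 2) + 1 := Nat.ceil_lt_add_one (by positivity)
  have h3 : |f x| ≤ |f x - f 0| + |f 0| := by simpa using abs_sub_le (f x) (f 0) 0
  have h4 : |x| / (δ / 2) = 2 / δ * |x| := by field_simp
  have h5 : 0 ≤ 2 / δ := by positivity
  nlinarith [abs_nonneg x, abs_nonneg (f 0), mul_nonneg (abs_nonneg x) (abs_nonneg (f 0))]

lemma absolutelyContinuousOn_of_dist_le {E : Type*} [PseudoMetricSpace E] {f : ℝ → E} {C : ℝ}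
    (hf : ∀ s t, dist (f s) (f t) ≤ C * |s - t|) (S : Set ℝ) : AbsolutelyContinuousOn f S := by
  have hC : 0 ≤ C := by simpa using dist_nonneg.trans (hf 1 0)
  intro ε hε
  refine ⟨ε / (C + 1), by positivity, fun n a b hab _ hsum => ?_⟩
  calc ∑ i, dist (f (a i)) (f (b i)) ≤ ∑ i, C * (b i - a i) := by
        refine Finset.sum_le_sum fun i _ => (hf _ _).trans_eq ?_
        rw [abs_sub_comm, abs_of_nonneg (sub_nonneg.2 (hab i).2.2)]
    _ = C * ∑ i, (b i - a i) := by rw [Finset.mul_sum]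
    _ ≤ C * (ε / (C + 1)) := by gcongr
    _ < ε := by
        rw [mul_div_assoc', div_lt_iff₀ (by positivity)]
        linarith

end AbsolutelyContinuous

/-! ### The projected free motion as a sticky flow -/

section Flow

variable {ρ : Measure ℝ}

/-- The curve of projections onto the monotone cone of the free motion `e + t w`. -/
def IsProjectedFlow (e w : Lp ℝ 2 ρ) (x : ℝ → Lp ℝ 2 ρ) : Prop :=
  ∀ t, IsConeProj (monotoneCone ρ) (e + t • w) (x t)

lemma exists_isProjectedFlow (e w : Lp ℝ 2 ρ) : ∃ x, IsProjectedFlow e w x :=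
  ⟨_, fun t => (isClosedConvexCone_monotoneCone.exists_isConeProj (e + t • w)).choose_spec⟩

namespace IsProjectedFlow

variable {e w : Lp ℝ 2 ρ} {x : ℝ → Lp ℝ 2 ρ}

lemma dist_le (h : IsProjectedFlow e w x) (s t : ℝ) : dist (x s) (x t) ≤ ‖w‖ * |s - t| := by
  rw [dist_eq_norm]
  refine ((h s).norm_sub_le (h t)).trans_eq ?_
  rw [add_sub_add_left_eq_sub, ← sub_smul, norm_smul, Real.norm_eq_abs, mul_comm]

lemma zero_eq (h : IsProjectedFlow e w x) (he : e ∈ monotoneCone ρ) : x 0 = e := by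
  have := h 0
  rw [zero_smul, add_zero] at this
  exact this.unique (isConeProj_self he)

variable [IsProbabilityMeasure ρ]

/-- A projection computed inside the range of `condProj (x s)` is also the projection onto the full
cone, and that is unique. The point is that `x t` is a function of `x s`. -/
lemma restart (h : IsProjectedFlow e w x) (he : e ∈ monotoneCone ρ) {s t : ℝ} (hs : 0 < s)
    (hst : s ≤ t) : IsConeProj (monotoneCone ρ ∩ {f | condProj (x s) f = f})
      (condProj (x s) (e + t • w)) (x t) := by
  obtain ⟨p, hp⟩ := (isClosedConvexCone_monotoneCone.inter_fixed
    (condProj (x s))).exists_isConeProj (condProj (x s) (e + t • w))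
  have := isConeProj_of_restart (isOrthProj_condProj (x s)) hs hst (h s) (h s).condProj_eq
    (fun g hg => condProj_mem_monotoneCone (h s).mem hg)
    (fun g hg => inner_sub_condProj_nonneg (x s) he hg) hp
  rwa [(h t).unique this]

lemma condProj_eq_self (h : IsProjectedFlow e w x) (he : e ∈ monotoneCone ρ) {s t : ℝ}
    (hs : 0 < s) (hst : s ≤ t) : condProj (x s) (x t) = x t :=
  (h.restart he hs hst).mem.2

lemma isProjectedLine (h : IsProjectedFlow e w x) (he : e ∈ monotoneCone ρ) :
    IsProjectedLine (fun t => condProj (x t)) e w x where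
  proj t _ := isOrthProj_condProj (x t)
  comp_left s t hs hst := condProj_comp_of_fixed' (h.condProj_eq_self he hs hst)
  comp_right s t hs hst := condProj_comp_of_fixed (h.condProj_eq_self he hs hst)
  eq_proj t _ := (h t).condProj_eq.symm
  norm_sub_le s t hs hst := by
    -- Both `x t` and `x s` are projections onto the same smaller cone, of data differing by `(t -
    -- s) E_s w`; this gives speed `‖E_s w‖` instead of `‖w‖`.
    refine ((h.restart he hs hst).norm_sub_le (h.restart he hs le_rfl)).trans_eq ?_
    rw [← map_sub, add_sub_add_left_eq_sub, ← sub_smul, map_smul, norm_smul, Real.norm_eq_abs,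
      abs_of_nonneg (sub_nonneg.2 hst)]

/-- The velocity at time `t` is a function of the position satisfying the one sided Lipschitz
bound with constant `1 / t`. -/
lemma exists_velocity_entropy (h : IsProjectedFlow e w x) (he : e ∈ monotoneCone ρ) {t : ℝ}
    (ht : 0 < t) : ∃ u : ℝ → ℝ, Measurable u ∧ ∃ R ∈ ae (ρ.map (x t)),
      (condProj (x t) w : ℝ → ℝ) =ᵐ[ρ] u ∘ (x t) ∧
      ∀ a ∈ R, ∀ b ∈ R, (u a - u b) * (a - b) ≤ 1 / t * (a - b) ^ 2 := by
  obtain ⟨A, hA, hxA⟩ := (h t).mem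
  obtain ⟨B, hB, heB⟩ := he
  obtain ⟨G, hGm, R, hR, hG, hEG⟩ := exists_monotoneOn_condExpGiven (Lp.measurable_coe (x t))
    (Lp.measurable_coe e)
    ((Lp.memLp e).integrable one_le_two) (inter_mem hA hB) (hxA.mono inter_subset_left)
    (heB.mono inter_subset_right)
  -- Solve `x t = E e + t E w` for `E w`, where `E e = G ∘ x t` with `G` monotone.
  refine ⟨fun a => (a - G a) / t, (measurable_id.sub hGm).div_const t, R, hR, ?_, fun a ha b hb => ?_⟩
  · have h1 : x t = condProj (x t) e + t • condProj (x t) w := by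
      conv_lhs => rw [← (h t).condProj_eq]
      rw [map_add, map_smul]
    filter_upwards [hEG, condProj_ae_eq (x t) e, Lp.coeFn_add (condProj (x t) e)
      (t • condProj (x t) w), Lp.coeFn_smul t (condProj (x t) w)] with y h2 h3 h4 h5
    rw [← h1, Pi.add_apply, h5, h3, h2, Pi.smul_apply, smul_eq_mul] at h4
    simp only [Function.comp_apply] at *
    field_simp
    linarith
  · have h2 : 0 ≤ (G a - G b) * (a - b) := by
      rcases le_total a b with hab | hab
      · exact mul_nonneg_of_nonpos_of_nonpos (sub_nonpos.2 (hG ha hb hab)) (sub_nonpos.2 hab)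
      · exact mul_nonneg (sub_nonneg.2 (hG hb ha hab)) (sub_nonneg.2 hab)
    have h3 : ((a - G a) / t - (b - G b) / t) * (a - b)
        = 1 / t * ((a - b) ^ 2 - (G a - G b) * (a - b)) := by field_simp; ring
    rw [h3]
    gcongr
    linarith

end IsProjectedFlow

end Flow

/-! ### Versions measurable jointly in time and space -/

section JointMeasurability

variable {ρ : Measure ℝ}

/-- A Lipschitz curve in `L²(ρ)` has a version that is jointly measurable in time and space. -/
lemma exists_jointly_measurable_version {x : ℝ → Lp ℝ 2 ρ} {C : ℝ}
    (hx : ∀ s t, dist (x s) (x t) ≤ C * |s - t|) :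
    ∃ Z : ℝ × ℝ → ℝ, Measurable Z ∧ ∀ t, (fun y => Z (t, y)) =ᵐ[ρ] x t := by
  have hC : 0 ≤ C := by simpa using dist_nonneg.trans (hx 1 0)
  -- Dyadic times: the discretised curve takes countably many values, hence is jointly measurable.
  let τ : ℕ → ℝ → ℝ := fun n t => ⌊t * 2 ^ n⌋ / 2 ^ n
  have hτ : ∀ n t, |τ n t - t| ≤ (1 / 2) ^ n := by
    intro n t
    have h2 : (0 : ℝ) < 2 ^ n := by positivity
    have h3 : τ n t - t = (⌊t * 2 ^ n⌋ - t * 2 ^ n) * (1 / 2) ^ n := by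
      simp only [τ, one_div, inv_pow]; field_simp
    rw [h3, abs_mul, abs_of_nonneg (show (0 : ℝ) ≤ (1 / 2) ^ n by positivity)]
    refine mul_le_of_le_one_left (by positivity) ?_
    rw [abs_le]
    constructor <;> linarith [Int.floor_le (t * 2 ^ n), Int.lt_floor_add_one (t * 2 ^ n)]
  have hdist : ∀ n t, dist (x (τ n t)) (x t) ≤ C * (1 / 2) ^ n := fun n t =>
    (hx _ _).trans (mul_le_mul_of_nonneg_left (hτ n t) hC)
  let z : ℕ → ℝ × ℝ → ℝ := fun n p => x (τ n p.1) p.2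
  have hz : ∀ n, Measurable (z n) := by
    intro n
    have h1 : Measurable fun q : ℤ × ℝ => x ((q.1 : ℝ) / 2 ^ n) q.2 :=
      measurable_from_prod_countable_right fun k => Lp.measurable_coe (x ((k : ℝ) / 2 ^ n))
    have h2 : Measurable fun p : ℝ × ℝ => (⌊p.1 * 2 ^ n⌋, p.2) :=
      (Int.measurable_floor.comp (measurable_fst.mul_const _)).prodMk measurable_snd
    exact h1.comp h2
  refine ⟨fun p => limsup (fun n => z n p) atTop, Measurable.limsup hz, fun t => ?_⟩
  have hlim : Tendsto (fun n => x (τ n t)) atTop (𝓝 (x t)) := by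
    rw [tendsto_iff_dist_tendsto_zero]
    refine squeeze_zero (fun _ => dist_nonneg) (fun n => hdist n t) ?_
    simpa using (tendsto_pow_atTop_nhds_zero_of_lt_one (by norm_num)
      (by norm_num : (1 / 2 : ℝ) < 1)).const_mul C
  obtain ⟨ns, hns, hsub⟩ := (tendstoInMeasure_of_tendsto_Lp hlim).exists_seq_tendsto_ae
  -- The errors `C 2⁻ⁿ` are summable, so the whole sequence converges almost everywhere for each
  -- `t`, and its limit agrees with the one along the subsequence. In the bound, `2 * C + 1` makes
  -- the inequality strict.
  have hconv : ∀ᵐ y ∂ρ, ∃ l, Tendsto (fun n => x (τ n t) y) atTop (𝓝 l) := by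
    refine Lp.ae_tendsto_of_cauchy_eLpNorm (p := 2) (fun n => Lp.aestronglyMeasurable _) one_le_two
      (B := fun n => ENNReal.ofReal ((2 * C + 1) * (1 / 2) ^ n)) ?_ ?_
    · exact (Summable.mul_left _ (summable_geometric_of_lt_one (by norm_num)
        (by norm_num))).tsum_ofReal_ne_top
    · intro N n m hn hm
      rw [← Lp.edist_def, edist_dist]
      refine (ENNReal.ofReal_lt_ofReal_iff (by positivity)).2 ?_
      have h1 : ∀ k, N ≤ k → dist (x (τ k t)) (x t) ≤ C * (1 / 2) ^ N := fun k hk =>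
        (hdist k t).trans (mul_le_mul_of_nonneg_left
          (pow_le_pow_of_le_one (by norm_num) (by norm_num) hk) hC)
      have h2 := dist_triangle_right (x (τ n t)) (x (τ m t)) (x t)
      have h3 : (0 : ℝ) < (1 / 2) ^ N := by positivity
      linarith [h1 n hn, h1 m hm]
  filter_upwards [hconv, hsub] with y ⟨l, hl⟩ hy
  rw [← tendsto_nhds_unique (hl.comp hns.tendsto_atTop) hy]
  exact hl.limsup_eq

variable [IsProbabilityMeasure ρ]

/-- The conditional expectations of `g` given the positions `x t` are given by a single jointly
measurable velocity field. -/
lemma exists_measurable_velocity {x : ℝ → Lp ℝ 2 ρ} {Z : ℝ × ℝ → ℝ} (hZ : Measurable Z)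
    (hZx : ∀ t, (fun y => Z (t, y)) =ᵐ[ρ] x t) {g : ℝ → ℝ} (hg : Integrable g ρ)
    (lam : Measure ℝ) [SFinite lam] :
    ∃ v : ℝ → ℝ → ℝ, Measurable (fun p : ℝ × ℝ => v p.1 p.2) ∧
      ∀ᵐ t ∂lam, (fun y => v (x t y) t) =ᵐ[ρ] condExpGiven ρ g (x t) := by
  -- A finite measure with the same null sets makes `g` integrable on the product; the velocity is
  -- its conditional expectation given `(position, time)`.
  let ν := lam.toFinite
  let M := ν.prod ρ
  let Φ : ℝ × ℝ → ℝ × ℝ := fun p => (Z p, p.1)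
  have hΦ : Measurable Φ := hZ.prodMk measurable_fst
  have hgM : Integrable (fun p : ℝ × ℝ => g p.2) M := hg.comp_snd ν
  have hu := (stronglyMeasurable_condExp (μ := M) (m := MeasurableSpace.comap Φ inferInstance)
    (f := fun p : ℝ × ℝ => g p.2)).measurable
  obtain ⟨h, hh, hhu⟩ := hu.exists_eq_measurable_comp
  refine ⟨fun a t => h (a, t), hh, ?_⟩
  have hDint : Integrable (fun p => h (Φ p) - g p.2) M := by
    refine Integrable.sub ?_ hgM
    change Integrable (h ∘ Φ) M
    rw [← hhu]
    exact integrable_condExp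
  have hD : ∀ T B : Set ℝ, MeasurableSet T → MeasurableSet B →
      ∫ p in Φ ⁻¹' (B ×ˢ T), (h (Φ p) - g p.2) ∂M = 0 := by
    intro T B hT hB
    have h1 := setIntegral_condExp hΦ.comap_le hgM ⟨B ×ˢ T, hB.prod hT, rfl⟩
    rw [hhu] at h1
    have h2 : Integrable (h ∘ Φ) M := by rw [← hhu]; exact integrable_condExp
    have h3 := integral_sub (μ := M.restrict (Φ ⁻¹' (B ×ˢ T))) h2.integrableOn hgM.integrableOn
    rw [h1, sub_self] at h3
    exact h3
  have hslice : ∀ B : Set ℝ, MeasurableSet B →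
      ∀ᵐ t ∂ν, ∫ y in {y | Z (t, y) ∈ B}, (h (Z (t, y), t) - g y) ∂ρ = 0 := by
    intro B hB
    have hI : Integrable ((Z ⁻¹' B).indicator fun p => h (Φ p) - g p.2) M :=
      hDint.indicator (hZ hB)
    have h1 : ∀ t, ∫ y, (Z ⁻¹' B).indicator (fun p => h (Φ p) - g p.2) (t, y) ∂ρ
        = ∫ y in {y | Z (t, y) ∈ B}, (h (Z (t, y), t) - g y) ∂ρ := by
      intro t
      have h2 : MeasurableSet {y | Z (t, y) ∈ B} := (hZ.comp measurable_prodMk_left) hB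
      rw [← integral_indicator h2]
      rfl
    have h2 := hI.integral_prod_left
    have h3 := h2.ae_eq_zero_of_forall_setIntegral_eq_zero fun T hT _ => by
      have h4 := setIntegral_prod (s := T) (t := univ) _ hI.integrableOn
      simp only [Measure.restrict_univ] at h4
      rw [← h4, setIntegral_indicator (hZ hB), ← hD T B hT hB]
      congr 2
      ext p
      simp [Φ, and_comm]
    filter_upwards [h3] with t ht
    rw [← h1]
    exact ht
  -- Rational rays suffice to identify the conditional expectation on a slice, so the null set of
  -- times can be chosen before the Borel set.
  have hall : ∀ᵐ t ∂ν, ∀ q : ℚ, ∫ y in {y | Z (t, y) ∈ Ioi (q : ℝ)}, (h (Z (t, y), t) - g y) ∂ρ = 0 :=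
    ae_all_iff.2 fun q => hslice _ measurableSet_Ioi
  have hae : ∀ᵐ t ∂ν, (fun y => h (x t y, t)) =ᵐ[ρ] condExpGiven ρ g (x t) := by
    filter_upwards [hall, hslice univ MeasurableSet.univ, hDint.prod_right_ae] with t h1 h2 h3
    have hxm := Lp.measurable_coe (x t)
    have hcongr : (fun y => h (Z (t, y), t) - g y) =ᵐ[ρ] fun y => h (x t y, t) - g y := by
      filter_upwards [hZx t] with y hy
      rw [hy]
    have h4 : Integrable (fun y => h (x t y, t) - g y) ρ := Integrable.congr h3 hcongr
    have h5 : Integrable (fun y => h (x t y, t)) ρ :=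
      (h4.add hg).congr (Eventually.of_forall fun y => by simp)
    refine ae_eq_condExp_of_forall_setIntegral_eq hxm.comap_le hg (fun s _ _ => h5.integrableOn) ?_
      ((hh.comp (measurable_id.prodMk measurable_const)).comp
        (comap_measurable _)).aestronglyMeasurable
    rintro s ⟨B, hB, rfl⟩ -
    have h6 := setIntegral_preimage_eq_zero h4 hxm
      (by rw [← integral_congr_ae hcongr]; simpa using h2) (fun q => by
        rw [← h1 q, ← integral_congr_ae (ae_restrict_of_ae hcongr)]
        refine setIntegral_congr_set ?_
        filter_upwards [hZx t] with y hy
        change (x t y ∈ Ioi (q : ℝ)) = (Z (t, y) ∈ Ioi (q : ℝ))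
        rw [hy]) hB
    rw [integral_sub h5.integrableOn hg.integrableOn] at h6
    linarith
  rwa [ae_toFinite] at hae

end JointMeasurability

/-! ### Quantitative bounds for test functions -/

section TestFunctions

/-- Bounds for a compactly supported smooth function `φ` of position and time, up to its second
order Taylor remainder. -/
structure TaylorBound (φ : ℝ → ℝ → ℝ) (C : ℝ) : Prop where
  nonneg : 0 ≤ C
  bound : ∀ x t, |φ x t| ≤ C
  bound_space : ∀ x t, |deriv (fun ξ => φ ξ t) x| ≤ C
  bound_time : ∀ x t, |deriv (fun τ => φ x τ) t| ≤ C
  lipschitz : ∀ x t y s, |φ y s - φ x t| ≤ C * (|y - x| + |s - t|)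
  taylor : ∀ x t y s, |φ y s - φ x t - (deriv (fun τ => φ x τ) t * (s - t)
    + deriv (fun ξ => φ ξ t) x * (y - x))| ≤ C * ((y - x) ^ 2 + (s - t) ^ 2)

lemma hasFDerivAt_apply_eq {φ : ℝ → ℝ → ℝ} {L : ℝ × ℝ →L[ℝ] ℝ} {x t : ℝ}
    (h : HasFDerivAt (fun p : ℝ × ℝ => φ p.1 p.2) L (x, t)) (a b : ℝ) :
    L (a, b) = deriv (fun τ => φ x τ) t * b + deriv (fun ξ => φ ξ t) x * a := by
  have h1 : HasDerivAt (fun τ => φ x τ) (L (0, 1)) t :=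
    h.comp_hasDerivAt (f := fun τ : ℝ => (x, τ)) t
      ((hasDerivAt_const t x).prodMk (hasDerivAt_id t))
  have h2 : HasDerivAt (fun ξ => φ ξ t) (L (1, 0)) x :=
    h.comp_hasDerivAt (f := fun ξ : ℝ => (ξ, t)) x
      ((hasDerivAt_id x).prodMk (hasDerivAt_const x t))
  have h3 : ((a, b) : ℝ × ℝ) = b • (0, 1) + a • (1, 0) := by simp
  rw [h1.deriv, h2.deriv, h3, map_add, map_smul, map_smul, smul_eq_mul, smul_eq_mul]
  ring

lemma continuous_partial_derivs {φ : ℝ → ℝ → ℝ} (hφ : ContDiff ℝ ∞ (fun p : ℝ × ℝ => φ p.1 p.2)) :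
    Continuous (fun p : ℝ × ℝ => deriv (fun ξ => φ ξ p.2) p.1) ∧
      Continuous (fun p : ℝ × ℝ => deriv (fun τ => φ p.1 τ) p.2) := by
  have hd : ∀ p : ℝ × ℝ, HasFDerivAt (fun p : ℝ × ℝ => φ p.1 p.2)
      (fderiv ℝ (fun p : ℝ × ℝ => φ p.1 p.2) p) (p.1, p.2) := fun p =>
    (hφ.differentiable (by simp)).differentiableAt.hasFDerivAt
  have hc := hφ.continuous_fderiv (by simp)
  constructor
  · refine (hc.clm_apply (continuous_const (y := ((1, 0) : ℝ × ℝ)))).congr fun p => ?_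
    simp [hasFDerivAt_apply_eq (hd p)]
  · refine (hc.clm_apply (continuous_const (y := ((0, 1) : ℝ × ℝ)))).congr fun p => ?_
    simp [hasFDerivAt_apply_eq (hd p)]

lemma exists_taylorBound {φ : ℝ → ℝ → ℝ} (hφ : ContDiff ℝ ∞ (fun p : ℝ × ℝ => φ p.1 p.2))
    (hc : HasCompactSupport (fun p : ℝ × ℝ => φ p.1 p.2)) : ∃ C, TaylorBound φ C := by
  set ψ : ℝ × ℝ → ℝ := fun p => φ p.1 p.2 with hψ
  have hd : ∀ p, HasFDerivAt ψ (fderiv ℝ ψ p) p := fun p =>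
    (hφ.differentiable (by simp)).differentiableAt.hasFDerivAt
  obtain ⟨C0, hC0⟩ := hφ.continuous.bounded_above_of_compact_support hc
  obtain ⟨C1, hC1⟩ := (hφ.continuous_fderiv (by simp)).bounded_above_of_compact_support
    (hc.fderiv ℝ)
  obtain ⟨C2, hC2⟩ := ContDiff.lipschitzWith_of_hasCompactSupport (hc.fderiv ℝ)
    (hφ.fderiv_right (m := 1) (by norm_cast)) one_ne_zero
  have hC0' : 0 ≤ C0 := (norm_nonneg _).trans (hC0 0)
  have hC1' : 0 ≤ C1 := (norm_nonneg _).trans (hC1 0)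
  have hC2' : (0 : ℝ) ≤ C2 := C2.2
  have happ : ∀ x t a b, fderiv ℝ ψ (x, t) (a, b)
      = deriv (fun τ => φ x τ) t * b + deriv (fun ξ => φ ξ t) x * a := fun x t =>
    hasFDerivAt_apply_eq (hd (x, t))
  have hnorm : ∀ a b : ℝ, ‖((a, b) : ℝ × ℝ)‖ ≤ |a| + |b| := fun a b => by
    rw [Prod.norm_mk]
    exact max_le (le_add_of_nonneg_right (abs_nonneg b)) (le_add_of_nonneg_left (abs_nonneg a))
  refine ⟨C0 + C1 + C2, by positivity, fun x t => ?_, fun x t => ?_, fun x t => ?_,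
    fun x t y s => ?_, fun x t y s => ?_⟩
  · linarith [hC0 (x, t), show |φ x t| = ‖ψ (x, t)‖ from rfl]
  · have h1 := (fderiv ℝ ψ (x, t)).le_of_opNorm_le (hC1 (x, t)) (1, 0)
    have h2 := happ x t 1 0
    simp only [mul_zero, zero_add, mul_one] at h2
    rw [h2, Prod.norm_mk] at h1
    simp at h1
    linarith
  · have h1 := (fderiv ℝ ψ (x, t)).le_of_opNorm_le (hC1 (x, t)) (0, 1)
    have h2 := happ x t 0 1
    simp only [mul_zero, add_zero, mul_one] at h2
    rw [h2, Prod.norm_mk] at h1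
    simp at h1
    linarith
  · have h1 := convex_univ.norm_image_sub_le_of_norm_hasFDerivWithin_le (f := ψ)
      (fun p _ => (hd p).hasFDerivWithinAt) (fun p _ => hC1 p) (mem_univ (x, t)) (mem_univ (y, s))
    calc |φ y s - φ x t| ≤ C1 * ‖(y, s) - (x, t)‖ := h1
      _ ≤ C1 * (|y - x| + |s - t|) := by gcongr; exact hnorm _ _
      _ ≤ (C0 + C1 + C2) * (|y - x| + |s - t|) := by gcongr; linarith
  · have h1 := (convex_segment (x, t) (y, s)).norm_image_sub_le_of_norm_hasFDerivWithin_le' (f := ψ)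
      (φ := fderiv ℝ ψ (x, t)) (C := C2 * ‖(y, s) - (x, t)‖)
      (fun p _ => (hd p).hasFDerivWithinAt) (fun p hp => by
        refine (hC2.norm_sub_le _ _).trans ?_
        gcongr
        obtain ⟨θ, hθ, rfl⟩ := segment_eq_image' ℝ (x, t) (y, s) ▸ hp
        rw [add_sub_cancel_left, norm_smul, Real.norm_of_nonneg hθ.1]
        exact mul_le_of_le_one_left (norm_nonneg _) hθ.2)
      (left_mem_segment ℝ _ _) (right_mem_segment ℝ _ _)
    rw [Prod.mk_sub_mk, happ] at h1
    have h2 : ‖((y - x, s - t) : ℝ × ℝ)‖ ^ 2 ≤ (y - x) ^ 2 + (s - t) ^ 2 := by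
      rw [Prod.norm_mk]
      rcases max_choice ‖y - x‖ ‖s - t‖ with h | h <;> rw [h, Real.norm_eq_abs, sq_abs]
      · linarith [sq_nonneg (s - t)]
      · linarith [sq_nonneg (y - x)]
    calc _ ≤ C2 * ‖((y - x, s - t) : ℝ × ℝ)‖ * ‖((y - x, s - t) : ℝ × ℝ)‖ := h1
      _ = C2 * ‖((y - x, s - t) : ℝ × ℝ)‖ ^ 2 := by ring
      _ ≤ C2 * ((y - x) ^ 2 + (s - t) ^ 2) := by gcongr
      _ ≤ (C0 + C1 + C2) * ((y - x) ^ 2 + (s - t) ^ 2) := by gcongr; linarith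

lemma exists_time_support_bound {φ : ℝ → ℝ → ℝ}
    (hc : HasCompactSupport (fun p : ℝ × ℝ => φ p.1 p.2)) :
    ∃ T > 0, ∀ x t, T ≤ t → φ x t = 0 := by
  obtain ⟨R, hR⟩ := hc.isBounded.subset_closedBall 0
  refine ⟨max R 0 + 1, by positivity, fun x t ht => ?_⟩
  by_contra hne
  have h1 := hR (subset_tsupport _ (Function.mem_support.2 hne : (x, t) ∈ _))
  rw [mem_closedBall_zero_iff, Prod.norm_mk] at h1
  have h2 := (le_max_right _ _).trans h1
  have h3 := le_abs_self t
  rw [Real.norm_eq_abs] at h2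
  linarith [le_max_left R 0]

end TestFunctions

/-! ### Weak differentiability from a dense set -/

section WeakDerivative

/-- Scalar differentiability of a curve against a dense set of vectors extends to all vectors when
the curve satisfies a Lipschitz bound at the point. -/
lemma hasDerivAt_inner_of_dense {H : Type*} [NormedAddCommGroup H] [InnerProductSpace ℝ H]
    {Φ : ℝ → H} {d : H} {t C : ℝ} (hΦ : ∀ s, ‖Φ s - Φ t‖ ≤ C * |s - t|) {S : Set H}
    (hS : Dense S) (h : ∀ w ∈ S, HasDerivAt (fun s => inner ℝ w (Φ s)) (inner ℝ w d) t) (w : H) :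
    HasDerivAt (fun s => inner ℝ w (Φ s)) (inner ℝ w d) t := by
  have hC : 0 ≤ C := by simpa using (norm_nonneg _).trans (hΦ (t + 1))
  rw [hasDerivAt_iff_isLittleO, Asymptotics.isLittleO_iff]
  intro c hc
  obtain ⟨w', hw', hdist⟩ := hS.exists_dist_lt w (show 0 < c / 2 / (C + ‖d‖ + 1) by positivity)
  have h1 := hasDerivAt_iff_isLittleO.1 (h w' hw')
  filter_upwards [Asymptotics.isLittleO_iff.1 h1 (half_pos hc)] with s hs
  simp only [Real.norm_eq_abs, smul_eq_mul] at hs ⊢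
  have h2 : inner ℝ w (Φ s) - inner ℝ w (Φ t) - (s - t) * inner ℝ w d
      = (inner ℝ w' (Φ s) - inner ℝ w' (Φ t) - (s - t) * inner ℝ w' d)
        + inner ℝ (w - w') (Φ s - Φ t - (s - t) • d) := by
    simp only [inner_sub_left, inner_sub_right, inner_smul_right]
    ring
  have h3 : ‖Φ s - Φ t - (s - t) • d‖ ≤ (C + ‖d‖ + 1) * |s - t| := by
    refine (norm_sub_le _ _).trans ?_
    rw [norm_smul, Real.norm_eq_abs]
    nlinarith [hΦ s, abs_nonneg (s - t)]
  have h4 : ‖w - w'‖ * ‖Φ s - Φ t - (s - t) • d‖ ≤ c / 2 * |s - t| := by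
    rw [dist_eq_norm] at hdist
    calc _ ≤ c / 2 / (C + ‖d‖ + 1) * ((C + ‖d‖ + 1) * |s - t|) := by gcongr
      _ = c / 2 * |s - t| := by field_simp
  rw [h2]
  have h5 := abs_real_inner_le_norm (w - w') (Φ s - Φ t - (s - t) • d)
  have h6 := abs_add_le (inner ℝ w' (Φ s) - inner ℝ w' (Φ t) - (s - t) * inner ℝ w' d)
    (inner ℝ (w - w') (Φ s - Φ t - (s - t) • d))
  linarith

end WeakDerivative

/-! ### Chain rule and transport identity along a Lipschitz curve in `L²(ρ)` -/

section Transport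

lemma hasDerivAt_zero_of_abs_sub_le_sq {f : ℝ → ℝ} {t K : ℝ}
    (h : ∀ s, |f s - f t| ≤ K * (s - t) ^ 2) : HasDerivAt f 0 t := by
  have h1 : (fun s => f s - f t) =O[𝓝 t] fun s => (s - t) ^ 2 :=
    Asymptotics.IsBigO.of_bound K (Eventually.of_forall fun s => by
      simpa [abs_of_nonneg (sq_nonneg (s - t))] using h s)
  have h2 : (fun s : ℝ => (s - t) ^ 2) =o[𝓝 t] fun s => s - t := by
    have h3 : Tendsto (fun s : ℝ => s - t) (𝓝 t) (𝓝 0) :=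
      tendsto_sub_nhds_zero_iff.2 tendsto_id
    exact (Asymptotics.isLittleO_pow_id one_lt_two).comp_tendsto h3
  rw [hasDerivAt_iff_isLittleO]
  simpa using h1.trans_isLittleO h2

variable {ρ : Measure ℝ}

lemma inner_eq_integral_of_ae_eq {f g : Lp ℝ 2 ρ} {f' g' : ℝ → ℝ} (hf : (f : ℝ → ℝ) =ᵐ[ρ] f')
    (hg : (g : ℝ → ℝ) =ᵐ[ρ] g') : inner ℝ f g = ∫ y, f' y * g' y ∂ρ := by
  rw [L2.inner_def]
  refine integral_congr_ae ?_
  filter_upwards [hf, hg] with y h1 h2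
  simp [h1, h2, mul_comm]

lemma norm_sq_eq_integral (f : Lp ℝ 2 ρ) : ‖f‖ ^ 2 = ∫ y, f y ^ 2 ∂ρ := by
  rw [← real_inner_self_eq_norm_sq, inner_eq_integral_of_ae_eq .rfl .rfl]
  simp only [sq]

lemma integral_sub_sq_eq (f g : Lp ℝ 2 ρ) : ∫ y, (f y - g y) ^ 2 ∂ρ = ‖f - g‖ ^ 2 := by
  rw [norm_sq_eq_integral]
  refine integral_congr_ae ?_
  filter_upwards [Lp.coeFn_sub f g] with y h1
  rw [h1, Pi.sub_apply]

lemma integrable_sub_sq (f g : Lp ℝ 2 ρ) : Integrable (fun y => (f y - g y) ^ 2) ρ :=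
  ((Lp.memLp f).sub (Lp.memLp g)).integrable_sq

variable [IsProbabilityMeasure ρ] {φ : ℝ → ℝ → ℝ} {C : ℝ} {x : ℝ → Lp ℝ 2 ρ}

lemma dense_bounded : Dense {w : Lp ℝ 2 ρ | ∃ b : ℝ → ℝ, Measurable b ∧ (∃ M, ∀ y, |b y| ≤ M) ∧
    (w : ℝ → ℝ) =ᵐ[ρ] b} := by
  refine Dense.mono ?_ (BoundedContinuousFunction.toLp_denseRange ℝ ρ (p := 2) ℝ (by simp))
  rintro _ ⟨b, rfl⟩
  exact ⟨b, b.continuous.measurable, ⟨‖b‖, b.norm_coe_le_norm⟩, BoundedContinuousFunction.coeFn_toLp _ _ ℝ b⟩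

lemma TaylorBound.memLp_comp (hC : TaylorBound φ C) (hφ : Continuous fun p : ℝ × ℝ => φ p.1 p.2)
    (f : Lp ℝ 2 ρ) (t : ℝ) : MemLp (fun y => φ (f y) t) 2 ρ :=
  memLp_of_bounded ((hφ.comp (continuous_id.prodMk continuous_const)).measurable.comp
    (Lp.measurable_coe f)) C fun _ => hC.bound _ _

lemma TaylorBound.memLp_deriv (hC : TaylorBound φ C)
    (hφ : ContDiff ℝ ∞ (fun p : ℝ × ℝ => φ p.1 p.2)) (f V : Lp ℝ 2 ρ) (t : ℝ) :
    MemLp (fun y => deriv (fun τ => φ (f y) τ) t + V y * deriv (fun ξ => φ ξ t) (f y)) 2 ρ := by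
  have h1 : Measurable fun y => deriv (fun ξ => φ ξ t) (f y) :=
    ((continuous_partial_derivs hφ).1.comp (continuous_id.prodMk continuous_const)).measurable.comp
      (Lp.measurable_coe f)
  have h2 : Measurable fun y => deriv (fun τ => φ (f y) τ) t :=
    ((continuous_partial_derivs hφ).2.comp (continuous_id.prodMk continuous_const)).measurable.comp
      (Lp.measurable_coe f)
  refine (memLp_of_bounded h2 C fun y => hC.bound_time _ _).add ?_
  refine (Lp.memLp V).of_le_mul (c := C) (((Lp.measurable_coe V).mul h1).aestronglyMeasurable)
    (Eventually.of_forall fun y => ?_)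
  rw [norm_mul, mul_comm]
  exact mul_le_mul_of_nonneg_right (hC.bound_space _ _) (norm_nonneg _)

lemma TaylorBound.norm_comp_sub_le (hC : TaylorBound φ C)
    (hφ : Continuous fun p : ℝ × ℝ => φ p.1 p.2) {L : ℝ}
    (hx : ∀ s t, dist (x s) (x t) ≤ L * |s - t|) (s t : ℝ) :
    ‖(hC.memLp_comp hφ (x s) s).toLp _ - (hC.memLp_comp hφ (x t) t).toLp _‖
      ≤ √(2 * C ^ 2 * (L ^ 2 + 1)) * |s - t| := by
  rw [← Real.sqrt_sq_eq_abs, ← Real.sqrt_mul (by positivity)]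
  refine Real.le_sqrt_of_sq_le ?_
  rw [norm_sq_eq_integral]
  have h1 : ∫ y, ((hC.memLp_comp hφ (x s) s).toLp _ - (hC.memLp_comp hφ (x t) t).toLp _ : Lp ℝ 2 ρ) y ^ 2 ∂ρ
      ≤ ∫ y, 2 * C ^ 2 * ((x s y - x t y) ^ 2 + (s - t) ^ 2) ∂ρ := by
    refine integral_mono_ae (Lp.memLp _).integrable_sq
      (((integrable_sub_sq _ _).add (integrable_const _)).const_mul _) ?_
    filter_upwards [Lp.coeFn_sub ((hC.memLp_comp hφ (x s) s).toLp _)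
      ((hC.memLp_comp hφ (x t) t).toLp _), (hC.memLp_comp hφ (x s) s).coeFn_toLp,
      (hC.memLp_comp hφ (x t) t).coeFn_toLp] with y h1 h2 h3
    rw [h1, Pi.sub_apply, h2, h3]
    have h4 := hC.lipschitz (x t y) t (x s y) s
    calc (φ (x s y) s - φ (x t y) t) ^ 2 = |φ (x s y) s - φ (x t y) t| ^ 2 := (sq_abs _).symm
      _ ≤ (C * (|x s y - x t y| + |s - t|)) ^ 2 := by gcongr
      _ ≤ 2 * C ^ 2 * (|x s y - x t y| ^ 2 + |s - t| ^ 2) := by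
          rw [mul_pow]
          nlinarith [mul_nonneg (sq_nonneg C) (sq_nonneg (|x s y - x t y| - |s - t|))]
      _ = _ := by rw [sq_abs, sq_abs]
  refine h1.trans ?_
  rw [integral_const_mul, integral_add (integrable_sub_sq _ _) (integrable_const _),
    integral_sub_sq_eq, ← dist_eq_norm]
  simp only [integral_const, probReal_univ, one_smul]
  have h2 : dist (x s) (x t) ^ 2 ≤ (L * |s - t|) ^ 2 := pow_le_pow_left₀ dist_nonneg (hx s t) 2
  rw [mul_pow, sq_abs] at h2
  calc _ ≤ 2 * C ^ 2 * (L ^ 2 * (s - t) ^ 2 + (s - t) ^ 2) := by gcongr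
    _ = _ := by ring

/-- The Taylor remainder is quadratic in `x s - x t`, hence controlled only in `L¹`; a bounded
weight can be paired with it. General weights in `L²` follow by density. -/
lemma TaylorBound.hasDerivAt_inner_of_bounded (hC : TaylorBound φ C)
    (hφ : ContDiff ℝ ∞ (fun p : ℝ × ℝ => φ p.1 p.2)) {L : ℝ}
    (hx : ∀ s t, dist (x s) (x t) ≤ L * |s - t|) {t : ℝ} {V : Lp ℝ 2 ρ} (hV : HasDerivAt x V t)
    {w : Lp ℝ 2 ρ} {b : ℝ → ℝ} (hb : Measurable b) {M : ℝ} (hM : ∀ y, |b y| ≤ M)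
    (hwb : (w : ℝ → ℝ) =ᵐ[ρ] b) :
    HasDerivAt (fun s => inner ℝ w ((hC.memLp_comp hφ.continuous (x s) s).toLp _))
      (inner ℝ w ((hC.memLp_deriv hφ (x t) V t).toLp _)) t := by
  have hM0 : 0 ≤ M := (abs_nonneg _).trans (hM 0)
  have hmx : Measurable fun y => deriv (fun ξ => φ ξ t) (x t y) :=
    ((continuous_partial_derivs hφ).1.comp (continuous_id.prodMk continuous_const)).measurable.comp
      (Lp.measurable_coe (x t))
  have hmt : Measurable fun y => deriv (fun τ => φ (x t y) τ) t :=
    ((continuous_partial_derivs hφ).2.comp (continuous_id.prodMk continuous_const)).measurable.comp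
      (Lp.measurable_coe (x t))
  have hu : MemLp (fun y => b y * deriv (fun ξ => φ ξ t) (x t y)) 2 ρ :=
    memLp_of_bounded (hb.mul hmx) (M * C) fun y => by
      rw [abs_mul]
      exact mul_le_mul (hM y) (hC.bound_space _ _) (abs_nonneg _) hM0
  have ha : Integrable (fun y => b y * deriv (fun τ => φ (x t y) τ) t) ρ :=
    (memLp_of_bounded (ρ := ρ) (hb.mul hmt) (M * C) fun y => by
      rw [Pi.mul_apply, abs_mul]
      exact mul_le_mul (hM y) (hC.bound_time _ _) (abs_nonneg _) hM0).integrable one_le_two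
  have hF : ∀ s, inner ℝ w ((hC.memLp_comp hφ.continuous (x s) s).toLp _)
      = ∫ y, b y * φ (x s y) s ∂ρ := fun s =>
    inner_eq_integral_of_ae_eq hwb (MemLp.coeFn_toLp _)
  have hu_inner : ∀ f : Lp ℝ 2 ρ, inner ℝ (hu.toLp _) f
      = ∫ y, b y * deriv (fun ξ => φ ξ t) (x t y) * f y ∂ρ := fun f =>
    inner_eq_integral_of_ae_eq hu.coeFn_toLp .rfl
  have hui : ∀ f : Lp ℝ 2 ρ,
      Integrable (fun y => b y * deriv (fun ξ => φ ξ t) (x t y) * f y) ρ := fun f =>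
    hu.integrable_mul (Lp.memLp f)
  have hbi : ∀ s, Integrable (fun y => b y * φ (x s y) s) ρ := fun s =>
    (memLp_of_bounded (ρ := ρ) hb M hM).integrable_mul (hC.memLp_comp hφ.continuous (x s) s)
  -- Removing the part affine in `(x s, s)` leaves a remainder of order `(s - t)²`, by the Taylor
  -- bound and the Lipschitz bound on `x`.
  have hrem : HasDerivAt (fun s => (∫ y, b y * φ (x s y) s ∂ρ) - (inner ℝ (hu.toLp _) (x s)
      + s * ∫ y, b y * deriv (fun τ => φ (x t y) τ) t ∂ρ)) 0 t := by
    refine hasDerivAt_zero_of_abs_sub_le_sq (K := M * C * (L ^ 2 + 1)) fun s => ?_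
    have h1 : (∫ y, b y * φ (x s y) s ∂ρ) - (inner ℝ (hu.toLp _) (x s)
          + s * ∫ y, b y * deriv (fun τ => φ (x t y) τ) t ∂ρ)
        - ((∫ y, b y * φ (x t y) t ∂ρ) - (inner ℝ (hu.toLp _) (x t)
          + t * ∫ y, b y * deriv (fun τ => φ (x t y) τ) t ∂ρ))
        = ∫ y, b y * (φ (x s y) s - φ (x t y) t - (deriv (fun τ => φ (x t y) τ) t * (s - t)
          + deriv (fun ξ => φ ξ t) (x t y) * (x s y - x t y))) ∂ρ := by
      have h2 : ∀ y, b y * (φ (x s y) s - φ (x t y) t - (deriv (fun τ => φ (x t y) τ) t * (s - t)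
          + deriv (fun ξ => φ ξ t) (x t y) * (x s y - x t y)))
          = (b y * φ (x s y) s - b y * φ (x t y) t)
            - (b y * deriv (fun τ => φ (x t y) τ) t * (s - t)
              + (b y * deriv (fun ξ => φ ξ t) (x t y) * x s y
                - b y * deriv (fun ξ => φ ξ t) (x t y) * x t y)) := fun y => by ring
      simp_rw [h2]
      have i1 : Integrable (fun y => b y * φ (x s y) s - b y * φ (x t y) t) ρ := (hbi s).sub (hbi t)
      have i2 : Integrable (fun y => b y * deriv (fun ξ => φ ξ t) (x t y) * x s y
          - b y * deriv (fun ξ => φ ξ t) (x t y) * x t y) ρ := (hui _).sub (hui _)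
      have i3 : Integrable (fun y => b y * deriv (fun τ => φ (x t y) τ) t * (s - t)
          + (b y * deriv (fun ξ => φ ξ t) (x t y) * x s y
            - b y * deriv (fun ξ => φ ξ t) (x t y) * x t y)) ρ := (ha.mul_const _).add i2
      rw [integral_sub i1 i3,
        integral_sub (hbi s) (hbi t), integral_add (ha.mul_const _) i2,
        integral_sub (hui _) (hui _), integral_mul_const, hu_inner, hu_inner]
      ring
    rw [h1]
    refine abs_integral_le_integral_abs.trans ?_
    have h3 : ∫ y, |b y * (φ (x s y) s - φ (x t y) t - (deriv (fun τ => φ (x t y) τ) t * (s - t)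
          + deriv (fun ξ => φ ξ t) (x t y) * (x s y - x t y)))| ∂ρ
        ≤ ∫ y, M * C * ((x s y - x t y) ^ 2 + (s - t) ^ 2) ∂ρ := by
      refine integral_mono_of_nonneg (Eventually.of_forall fun y => abs_nonneg _)
        (((integrable_sub_sq _ _).add (integrable_const _)).const_mul _)
        (Eventually.of_forall fun y => ?_)
      simp only [abs_mul, mul_assoc]
      exact mul_le_mul (hM y) (hC.taylor _ _ _ _) (abs_nonneg _) hM0
    refine h3.trans ?_
    rw [integral_const_mul, integral_add (integrable_sub_sq _ _) (integrable_const _),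
      integral_sub_sq_eq, ← dist_eq_norm]
    simp only [integral_const, probReal_univ, one_smul]
    have h4 : dist (x s) (x t) ^ 2 ≤ (L * |s - t|) ^ 2 := pow_le_pow_left₀ dist_nonneg (hx s t) 2
    rw [mul_pow, sq_abs] at h4
    have := hC.nonneg
    calc _ ≤ M * C * (L ^ 2 * (s - t) ^ 2 + (s - t) ^ 2) := by gcongr
      _ = _ := by ring
  have hlin : HasDerivAt (fun s => inner ℝ (hu.toLp _) (x s)
      + s * ∫ y, b y * deriv (fun τ => φ (x t y) τ) t ∂ρ)
      (inner ℝ (hu.toLp _) V + ∫ y, b y * deriv (fun τ => φ (x t y) τ) t ∂ρ) t := by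
    refine HasDerivAt.add ?_ (by simpa using (hasDerivAt_id t).mul_const _)
    exact (innerSL ℝ (hu.toLp _)).hasFDerivAt.comp_hasDerivAt t hV
  have hsum := hrem.add hlin
  have hval : inner ℝ w ((hC.memLp_deriv hφ (x t) V t).toLp _)
      = 0 + (inner ℝ (hu.toLp _) V + ∫ y, b y * deriv (fun τ => φ (x t y) τ) t ∂ρ) := by
    rw [inner_eq_integral_of_ae_eq hwb (MemLp.coeFn_toLp _), hu_inner, zero_add,
      ← integral_add (hui V) ha]
    congr 1 with y
    ring
  rw [hval]
  refine hsum.congr_of_eventuallyEq (Eventually.of_forall fun s => ?_)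
  simp only [Pi.add_apply, hF]
  ring

lemma TaylorBound.hasDerivAt_inner (hC : TaylorBound φ C)
    (hφ : ContDiff ℝ ∞ (fun p : ℝ × ℝ => φ p.1 p.2)) {L : ℝ}
    (hx : ∀ s t, dist (x s) (x t) ≤ L * |s - t|) {t : ℝ} {V : Lp ℝ 2 ρ} (hV : HasDerivAt x V t)
    (w : Lp ℝ 2 ρ) :
    HasDerivAt (fun s => inner ℝ w ((hC.memLp_comp hφ.continuous (x s) s).toLp _))
      (inner ℝ w ((hC.memLp_deriv hφ (x t) V t).toLp _)) t := by
  refine hasDerivAt_inner_of_dense (fun s => hC.norm_comp_sub_le hφ.continuous hx s t)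
    dense_bounded ?_ w
  rintro w ⟨b, hb, ⟨M, hM⟩, hwb⟩
  exact hC.hasDerivAt_inner_of_bounded hφ hx hV hb hM hwb

/-- The transport identity for a Lipschitz curve in `L²(ρ)`, tested against `w` and `φ`. -/
lemma integral_transport_eq {L : ℝ} (hx : ∀ s t, dist (x s) (x t) ≤ L * |s - t|)
    {V : ℝ → Lp ℝ 2 ρ} {D : Set ℝ} (hD : D.Countable)
    (hV : ∀ t, 0 < t → t ∉ D → HasDerivAt x (V t) t)
    (hφ : ContDiff ℝ ∞ (fun p : ℝ × ℝ => φ p.1 p.2))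
    (hc : HasCompactSupport (fun p : ℝ × ℝ => φ p.1 p.2)) (w : Lp ℝ 2 ρ) {G : ℝ → ℝ}
    (hG : ∀ᵐ t ∂(volume.restrict (Ici (0 : ℝ))), G t = ∫ y, w y *
      (deriv (fun τ => φ (x t y) τ) t + V t y * deriv (fun ξ => φ ξ t) (x t y)) ∂ρ) :
    (∫ t in Ici (0 : ℝ), G t) + ∫ y, w y * φ (x 0 y) 0 ∂ρ = 0 := by
  obtain ⟨C, hC⟩ := exists_taylorBound hφ hc
  obtain ⟨T, hT, hφT⟩ := exists_time_support_bound hc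
  let F : ℝ → ℝ := fun s => inner ℝ w ((hC.memLp_comp hφ.continuous (x s) s).toLp _)
  have hF : ∀ s, F s = ∫ y, w y * φ (x s y) s ∂ρ := fun s =>
    inner_eq_integral_of_ae_eq .rfl (MemLp.coeFn_toLp _)
  have hFT : ∀ s, T ≤ s → F s = 0 := fun s hs => by rw [hF]; simp [hφT _ _ hs]
  have hFL : LipschitzWith (‖w‖ * √(2 * C ^ 2 * (L ^ 2 + 1))).toNNReal F := by
    refine LipschitzWith.of_dist_le' fun s t => ?_
    rw [Real.dist_eq, Real.dist_eq, ← inner_sub_right, mul_assoc]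
    exact (abs_real_inner_le_norm _ _).trans
      (mul_le_mul_of_nonneg_left (hC.norm_comp_sub_le hφ.continuous hx s t) (norm_nonneg _))
  have hderiv : ∀ t, 0 < t → t ∉ D →
      HasDerivAt F (inner ℝ w ((hC.memLp_deriv hφ (x t) (V t) t).toLp _)) t := fun t ht htD =>
    hC.hasDerivAt_inner hφ hx (hV t ht htD) w
  have hGd : ∀ᵐ t ∂(volume.restrict (Ici (0 : ℝ))), G t = deriv F t := by
    have h1 : ∀ᵐ t ∂(volume.restrict (Ici (0 : ℝ))), t ∉ D :=
      ae_restrict_of_ae (hD.ae_notMem volume)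
    have h2 : ∀ᵐ t ∂(volume.restrict (Ici (0 : ℝ))), 0 < t := by
      rw [← restrict_Ioi_eq_restrict_Ici]
      exact ae_restrict_mem measurableSet_Ioi
    filter_upwards [hG, h1, h2] with t h3 h4 h5
    rw [h3, (hderiv t h5 h4).deriv]
    exact (inner_eq_integral_of_ae_eq .rfl (MemLp.coeFn_toLp _)).symm
  have hbd : ∀ t, ‖deriv F t‖ ≤ (‖w‖ * √(2 * C ^ 2 * (L ^ 2 + 1))).toNNReal := fun t =>
    norm_deriv_le_of_lipschitz hFL
  have hint : IntervalIntegrable (deriv F) volume 0 T := by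
    rw [intervalIntegrable_iff]
    exact Measure.integrableOn_of_bounded (by simp) (measurable_deriv F).aestronglyMeasurable
      (Eventually.of_forall hbd)
  -- A continuous function differentiable off a countable set, with integrable derivative, is
  -- recovered from it.
  have hftc := integral_eq_of_hasDerivAt_off_countable F (deriv F) hD hFL.continuous.continuousOn
    (fun t ht => (hderiv t (by simpa [hT.le] using ht.1.1) ht.2).differentiableAt.hasDerivAt) hint
  have hzero : ∀ t ∈ Ioi (0 : ℝ) \ Ioc 0 T, deriv F t = 0 := by
    rintro t ⟨h1, h2⟩
    have h3 : T < t := by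
      by_contra! h
      exact h2 ⟨h1, h⟩
    have h4 : F =ᶠ[𝓝 t] fun _ => 0 := by
      filter_upwards [lt_mem_nhds h3] with s hs using hFT s hs.le
    rw [h4.deriv_eq, deriv_const]
  rw [integral_congr_ae hGd, integral_Ici_eq_integral_Ioi,
    setIntegral_eq_of_subset_of_forall_sdiff_eq_zero measurableSet_Ioi Ioc_subset_Ioi_self hzero,
    ← intervalIntegral.integral_of_le hT.le, hftc, hFT T le_rfl, hF]
  simp

end Transport

/-! ### Energies, laws of positions and the averaging identity -/

section StickyFlow

variable {ρ₀ : Measure ℝ}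

lemma lintegral_ofReal_sq_of_ae_eq {f : Lp ℝ 2 ρ₀} {g : ℝ → ℝ} (h : (f : ℝ → ℝ) =ᵐ[ρ₀] g) :
    ∫⁻ y, ENNReal.ofReal (g y ^ 2) ∂ρ₀ = ENNReal.ofReal (‖f‖ ^ 2) := by
  rw [norm_sq_eq_integral, ofReal_integral_eq_lintegral_ofReal (Lp.memLp f).integrable_sq
    (Eventually.of_forall fun _ => sq_nonneg _)]
  refine lintegral_congr_ae ?_
  filter_upwards [h] with y hy
  rw [hy]

lemma kineticEnergy_of_ae_eq {f : Lp ℝ 2 ρ₀} {g : ℝ → ℝ} (h : (f : ℝ → ℝ) =ᵐ[ρ₀] g) :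
    kineticEnergy ρ₀ g = ENNReal.ofReal (1 / 2) * ENNReal.ofReal (‖f‖ ^ 2) := by
  rw [← lintegral_ofReal_sq_of_ae_eq h, ← lintegral_const_mul' _ _ ENNReal.ofReal_ne_top]
  simp only [kineticEnergy, ENNReal.ofReal_mul (show (0 : ℝ) ≤ 1 / 2 by norm_num)]

lemma memLp_id_of_integrable_sq (h : Integrable (fun x : ℝ => x ^ 2) ρ₀) :
    MemLp (fun x : ℝ => x) 2 ρ₀ :=
  (memLp_two_iff_integrable_sq aestronglyMeasurable_id).2 h

variable [IsProbabilityMeasure ρ₀]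

lemma AbsolutelyContinuousOn.memLp {v₀ : ℝ → ℝ} (hv : AbsolutelyContinuousOn v₀ univ)
    (h : Integrable (fun x : ℝ => x ^ 2) ρ₀) : MemLp v₀ 2 ρ₀ := by
  obtain ⟨C, hC⟩ := hv.exists_linear_growth
  have h1 : MemLp (fun x : ℝ => 1 + |x|) 2 ρ₀ :=
    (memLp_const (1 : ℝ)).add (memLp_id_of_integrable_sq h).norm
  refine h1.of_le_mul (c := C) hv.continuous.aestronglyMeasurable (Eventually.of_forall fun x => ?_)
  rw [Real.norm_of_nonneg (show (0 : ℝ) ≤ 1 + |x| by positivity)]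
  exact hC x

/-- Self-adjointness, with `h ∘ k` fixed by the projection. It trades `v₀` for the velocity in the
momentum equation and in the Radon–Nikodym identity. -/
lemma integral_condProj_mul_comp (k w : Lp ℝ 2 ρ₀) {h : ℝ → ℝ} (hh : Measurable h)
    (hm : MemLp (h ∘ k) 2 ρ₀) : ∫ y, condProj k w y * h (k y) ∂ρ₀ = ∫ y, w y * h (k y) ∂ρ₀ := by
  have h1 : condProj k (hm.toLp _) = hm.toLp _ := condProj_eq_self_of_ae_eq_comp hh hm.coeFn_toLp
  have h2 := (isOrthProj_condProj k).symm w (hm.toLp _)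
  rw [h1, inner_eq_integral_of_ae_eq .rfl hm.coeFn_toLp,
    inner_eq_integral_of_ae_eq .rfl hm.coeFn_toLp] at h2
  exact h2

/-- The law of the position at each time. -/
noncomputable def positionLaw (x : ℝ → Lp ℝ 2 ρ₀) (t : ℝ) : ProbabilityMeasure ℝ :=
  ⟨ρ₀.map (x t), Measure.isProbabilityMeasure_map (Lp.measurable_coe (x t)).aemeasurable⟩

lemma continuous_positionLaw {x : ℝ → Lp ℝ 2 ρ₀} (hx : Continuous x) :
    Continuous (positionLaw x) :=
  continuous_iff_continuousAt.2 fun t =>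
    ((tendstoInMeasure_of_tendsto_Lp (hx.tendsto t)).tendstoInDistribution
      fun s => (Lp.measurable_coe (x s)).aemeasurable).tendsto

lemma integral_positionLaw (x : ℝ → Lp ℝ 2 ρ₀) (t : ℝ) {f : ℝ → ℝ} (hf : Measurable f) :
    ∫ a, f a ∂(positionLaw x t : Measure ℝ) = ∫ y, f (x t y) ∂ρ₀ :=
  integral_map (Lp.measurable_coe (x t)).aemeasurable hf.aestronglyMeasurable

lemma lintegral_positionLaw (x : ℝ → Lp ℝ 2 ρ₀) (t : ℝ) {f : ℝ → ℝ≥0∞} (hf : Measurable f) :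
    ∫⁻ a, f a ∂(positionLaw x t : Measure ℝ) = ∫⁻ y, f (x t y) ∂ρ₀ :=
  lintegral_map hf (Lp.measurable_coe (x t))

end StickyFlow

/-! ### Assembly of the solution -/

theorem corollary1p2 (ρ₀ : Measure ℝ) [IsProbabilityMeasure ρ₀]
    (hρ₀ : Integrable (fun x : ℝ => x ^ 2) ρ₀)
    (v₀ : ℝ → ℝ) (hv₀ : AbsolutelyContinuousOn v₀ univ) :
    ∃ (X : ℝ → Lp ℝ 2 ρ₀) (ρ : ℝ → ProbabilityMeasure ℝ) (v : ℝ → ℝ → ℝ),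
      IsWeakSolutionPair ρ₀ v₀ ρ v ∧
      -- the pair is generated by a solution of the sticky particle flow equation
      IsStickyParticleFlow ρ₀ v₀ X ∧
      (∀ t : ℝ, 0 ≤ t → (ρ t : Measure ℝ) = ρ₀.map (X t)) ∧
      IsRadonNikodymVelocity ρ₀ v₀ X ρ v ∧
      (∀ᵐ t ∂(volume.restrict (Ici (0 : ℝ))),
        (fun y => v (X t y) t) =ᵐ[ρ₀] ((deriv X t : Lp ℝ 2 ρ₀) : ℝ → ℝ)) ∧
      -- the kinetic energy is finite, nonincreasing and bounded by the initial energy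
      kineticEnergy ρ₀ v₀ < ⊤ ∧
      (∃ N : Set ℝ, volume N = 0 ∧ ∀ s t : ℝ, 0 ≤ s → s ≤ t → s ∉ N → t ∉ N →
        kineticEnergy (ρ t) (fun x => v x t) ≤ kineticEnergy (ρ s) (fun x => v x s) ∧
        kineticEnergy (ρ s) (fun x => v x s) ≤ kineticEnergy ρ₀ v₀) ∧
      -- the entropy inequality, on a set of full measure
      (∀ᵐ t ∂(volume.restrict (Ioi (0 : ℝ))),
        ∃ A : Set ℝ, MeasurableSet A ∧ (ρ t : Measure ℝ) Aᶜ = 0 ∧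
          ∀ x ∈ A, ∀ y ∈ A, (v x t - v y t) * (x - y) ≤ 1 / t * (x - y) ^ 2) := by
  have hid := memLp_id_of_integrable_sq hρ₀
  have hv := hv₀.memLp hρ₀
  have he : hid.toLp _ ∈ monotoneCone ρ₀ :=
    mem_monotoneCone_of_ae_eq univ_mem (monotone_id.monotoneOn _) hid.coeFn_toLp
  set w := hv.toLp v₀
  obtain ⟨x, hflow⟩ := exists_isProjectedFlow (hid.toLp _) w
  have hline := hflow.isProjectedLine he
  have hLip := hflow.dist_le
  have hxc : Continuous x := (LipschitzWith.of_dist_le' hLip).continuous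
  have hx0 : (x 0 : ℝ → ℝ) =ᵐ[ρ₀] id := by
    rw [hflow.zero_eq he]
    exact hid.coeFn_toLp
  have hxm : ∀ t, Measurable (x t : ℝ → ℝ) := fun t => Lp.measurable_coe (x t)
  obtain ⟨D, hD, hderiv⟩ := hline.exists_countable_hasDerivAt
  obtain ⟨Z, hZ, hZx⟩ := exists_jointly_measurable_version hLip
  obtain ⟨v, hvm, hvx⟩ := exists_measurable_velocity hZ hZx (hv.integrable one_le_two)
    (volume.restrict (Ici 0))
  have hvt : ∀ t, Measurable fun a => v a t := fun t =>
    hvm.comp (measurable_id.prodMk measurable_const)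
  have hgood : ∀ᵐ t ∂(volume.restrict (Ici (0 : ℝ))), 0 < t ∧ HasDerivAt x (condProj (x t) w) t ∧
      (fun y => v (x t y) t) =ᵐ[ρ₀] condProj (x t) w := by
    have h1 : ∀ᵐ t ∂(volume.restrict (Ici (0 : ℝ))), t ∉ D :=
      ae_restrict_of_ae (hD.ae_notMem volume)
    have h2 : ∀ᵐ t ∂(volume.restrict (Ici (0 : ℝ))), 0 < t := by
      rw [← restrict_Ioi_eq_restrict_Ici]
      exact ae_restrict_mem measurableSet_Ioi
    filter_upwards [h1, h2, hvx] with t h3 h4 h5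
    exact ⟨h4, hderiv t h4 h3, h5.trans (condProj_ae_eq_of_toLp (x t) hv).symm⟩
  have hkin : ∀ t, (fun y => v (x t y) t) =ᵐ[ρ₀] condProj (x t) w →
      kineticEnergy (positionLaw x t) (fun a => v a t)
        = ENNReal.ofReal (1 / 2) * ENNReal.ofReal (‖condProj (x t) w‖ ^ 2) := fun t ht => by
    rw [← kineticEnergy_of_ae_eq ht.symm]
    exact lintegral_positionLaw x t (by have := hvt t; fun_prop)
  have hkin0 : kineticEnergy ρ₀ v₀ = ENNReal.ofReal (1 / 2) * ENNReal.ofReal (‖w‖ ^ 2) :=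
    kineticEnergy_of_ae_eq hv.coeFn_toLp
  refine ⟨x, positionLaw x, v, ?_, ?_, fun _ _ => rfl, ?_, ?_, ?_, ?_, ?_⟩
  · refine ⟨hv₀.continuous, hv.integrable one_le_two, (continuous_positionLaw hxc).continuousOn,
      hvm, fun T hT => ?_, fun φ hφ hc => ?_, fun φ hφ hc => ?_⟩
    · have h1 : ∀ᵐ t ∂(volume.restrict (Icc 0 T)),
          ∫⁻ a, ENNReal.ofReal (v a t ^ 2) ∂(positionLaw x t : Measure ℝ)
            ≤ ENNReal.ofReal (‖w‖ ^ 2) := by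
        filter_upwards [ae_restrict_of_ae_restrict_of_subset Icc_subset_Ici_self hgood] with t ht
        rw [lintegral_positionLaw x t (by have := hvt t; fun_prop),
          lintegral_ofReal_sq_of_ae_eq ht.2.2.symm]
        exact ENNReal.ofReal_le_ofReal
          (pow_le_pow_left₀ (norm_nonneg _) ((isOrthProj_condProj (x t)).norm_le w) 2)
      refine (lintegral_mono_ae h1).trans_lt ?_
      rw [lintegral_const]
      exact ENNReal.mul_lt_top ENNReal.ofReal_lt_top (by simp)
    · obtain ⟨hφx, hφt⟩ := continuous_partial_derivs hφ
      have h1 := integral_transport_eq hLip hD hderiv hφ hc ((memLp_const (1 : ℝ)).toLp _)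
        (G := fun t => ∫ a, (deriv (fun τ => φ a τ) t + v a t * deriv (fun ξ => φ ξ t) a)
          ∂(positionLaw x t : Measure ℝ)) (by
          filter_upwards [hgood] with t ht
          have hm : Measurable fun a => deriv (fun τ => φ a τ) t
              + v a t * deriv (fun ξ => φ ξ t) a :=
            (hφt.comp (continuous_id.prodMk continuous_const)).measurable.add
              ((hvt t).mul (hφx.comp (continuous_id.prodMk continuous_const)).measurable)
          rw [integral_positionLaw x t hm]
          refine integral_congr_ae ?_
          filter_upwards [ht.2.2, (memLp_const (μ := ρ₀) (p := 2) (1 : ℝ)).coeFn_toLp]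
            with y h2 h3
          rw [h2, h3, one_mul])
      refine Eq.trans (congrArg _ (integral_congr_ae ?_)) h1
      filter_upwards [hx0, (memLp_const (μ := ρ₀) (p := 2) (1 : ℝ)).coeFn_toLp] with y h2 h3
      rw [h2, h3, one_mul, id]
    · obtain ⟨hφx, hφt⟩ := continuous_partial_derivs hφ
      obtain ⟨C, hC⟩ := exists_taylorBound hφ hc
      have h1 := integral_transport_eq hLip hD hderiv hφ hc w
        (G := fun t => ∫ a, (v a t * deriv (fun τ => φ a τ) t
          + v a t ^ 2 * deriv (fun ξ => φ ξ t) a) ∂(positionLaw x t : Measure ℝ)) (by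
          filter_upwards [hgood] with t ht
          have hφt' : Measurable fun a => deriv (fun τ => φ a τ) t :=
            (hφt.comp (continuous_id.prodMk continuous_const)).measurable
          have hφx' : Measurable fun a => deriv (fun ξ => φ ξ t) a :=
            (hφx.comp (continuous_id.prodMk continuous_const)).measurable
          have h2 : (fun y => deriv (fun τ => φ (x t y) τ) t
              + condProj (x t) w y * deriv (fun ξ => φ ξ t) (x t y)) =ᵐ[ρ₀]
              (fun a => deriv (fun τ => φ a τ) t + v a t * deriv (fun ξ => φ ξ t) a) ∘ x t := by
            filter_upwards [ht.2.2] with y hy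
            simp only [Function.comp_apply, hy]
          -- The transport identity weighted by `v₀` produces `v₀ (∂ₜφ + v ∂ₓφ)`. The bracket is a
          -- function of `x t`, so averaging turns `v₀` into `v` and yields the quadratic flux.
          have h3 := integral_condProj_mul_comp (x t) w (hφt'.add ((hvt t).mul hφx'))
            ((memLp_congr_ae h2).1 (hC.memLp_deriv hφ (x t) (condProj (x t) w) t))
          have hm : Measurable fun a => v a t * deriv (fun τ => φ a τ) t
              + v a t ^ 2 * deriv (fun ξ => φ ξ t) a :=
            ((hvt t).mul hφt').add (((hvt t).pow_const 2).mul hφx')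
          rw [integral_positionLaw x t hm]
          trans ∫ y, w y * (deriv (fun τ => φ (x t y) τ) t
            + v (x t y) t * deriv (fun ξ => φ ξ t) (x t y)) ∂ρ₀
          · refine Eq.trans (integral_congr_ae ?_) h3
            filter_upwards [ht.2.2] with y hy
            simp only [Pi.add_apply, Pi.mul_apply, ← hy]
            ring
          · refine integral_congr_ae ?_
            filter_upwards [ht.2.2] with y hy
            rw [hy])
      refine Eq.trans (congrArg _ (integral_congr_ae ?_)) h1
      filter_upwards [hx0, hv.coeFn_toLp] with y h2 h3
      rw [h2, h3, id, mul_comm]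
  · refine ⟨absolutelyContinuousOn_of_dist_le hLip _, ?_, hx0⟩
    filter_upwards [hgood] with t ht
    refine ⟨ht.2.1.differentiableAt, ?_⟩
    rw [ht.2.1.deriv]
    exact condProj_ae_eq_of_toLp (x t) hv
  · intro S hS
    refine integral_congr_ae ?_
    filter_upwards [hgood] with t ht
    have hSt : MeasurableSet {a : ℝ | (a, t) ∈ S} := measurable_prodMk_right hS
    -- For fixed `t` the Radon–Nikodym identity is the averaging identity tested on the indicator of
    -- a time slice of `S`.
    have hχ : Measurable ({a : ℝ | (a, t) ∈ S}.indicator fun _ => (1 : ℝ)) :=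
      measurable_const.indicator hSt
    have h1 := integral_condProj_mul_comp (x t) w hχ
      (memLp_of_bounded (hχ.comp (hxm t)) 1 fun y => by
        simp only [Function.comp_apply, indicator]
        split_ifs <;> simp)
    have hm : Measurable fun a => S.indicator (fun p => v p.1 p.2) (a, t) :=
      (hvm.indicator hS).comp measurable_prodMk_right
    rw [integral_positionLaw x t hm]
    congr 1
    trans ∫ y, w y * {a : ℝ | (a, t) ∈ S}.indicator (fun _ => (1 : ℝ)) (x t y) ∂ρ₀
    · refine integral_congr_ae ?_
      filter_upwards [hv.coeFn_toLp] with y hy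
      rw [hy]
      by_cases hy' : (x t y, t) ∈ S <;> simp [hy', indicator]
    · rw [← h1]
      refine integral_congr_ae ?_
      filter_upwards [ht.2.2] with y hy
      rw [← hy]
      by_cases hy' : (x t y, t) ∈ S <;> simp [hy', indicator]
  · filter_upwards [hgood] with t ht
    rw [ht.2.1.deriv]
    exact ht.2.2
  · rw [hkin0]
    exact ENNReal.mul_lt_top ENNReal.ofReal_lt_top ENNReal.ofReal_lt_top
  · rw [ae_restrict_iff' measurableSet_Ici] at hgood
    -- The null set `N` is the set of nonnegative times at which `hgood` fails.
    refine ⟨_, hgood, fun s t hs hst hsN htN => ?_⟩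
    have hs' := not_not.1 hsN hs
    have ht' := not_not.1 htN (hs.trans hst)
    rw [hkin s hs'.2.2, hkin t ht'.2.2, hkin0]
    refine ⟨?_, ?_⟩
    · exact mul_le_mul' le_rfl (ENNReal.ofReal_le_ofReal (hline.antitoneOn hs'.1 ht'.1 hst))
    · gcongr
      exact (isOrthProj_condProj (x s)).norm_le w
  · filter_upwards [ae_restrict_of_ae_restrict_of_subset Ioi_subset_Ici_self hgood] with t ht
    obtain ⟨u, hu, R, hR, hVu, hent⟩ := hflow.exists_velocity_entropy he ht.1
    -- The jointly measurable `v` and the fixed-time velocity `u` agree only almost everywhere for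
    -- the law of `x t`, so the entropy set must be cut down accordingly.
    have h1 : {a | v a t = u a} ∈ ae (ρ₀.map (x t)) := by
      refine (ae_map_iff (hxm t).aemeasurable (measurableSet_eq_fun (hvt t) hu)).2 ?_
      exact ht.2.2.trans hVu
    obtain ⟨A, hA0, hA, hAR⟩ := IsMeasurablyGenerated.exists_measurable_subset (inter_mem h1 hR)
    refine ⟨A, hA, hA0, fun a ha b hb => ?_⟩
    rw [show v a t = u a from (hAR ha).1, show v b t = u b from (hAR hb).1]
    exact hent a (hAR ha).2 b (hAR hb).2
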